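/- **Conventions.** A *topos* is an elementary topos: a category with finite limits, exponentials and a subobject classifier $\mathrm{true}:1\to\Omega$ (binary products and the terminal object are chosen). A functor $L:\mathcal E\to\mathcal F$ between toposes is *logical* if it preserves finite products, exponentials (the canonical morphisms $L(B^A)\to (LB)^{LA}$ are invertible) and the subobject classifier (the morphism $L\Omega_{\mathcal E}\to\Omega_{\mathcal F}$ classifying $L(\mathrm{true})$ is invertible). A *signature* $(\Sigma,E)$ is a set $\Sigma$ of operation symbols of finite arity together with a set $E$ of equations between $\Sigma$-terms, each in a finite context of variables. A $(\Sigma,E)$-*algebra* in a topos is an object $A$ with morphisms $\sigma^A:A^n\to A$, for $\sigma\in\Sigma$ of arity $n$, satisfying the equations of $E$. The product $A\times B$ of two algebras and the terminal object $1$ are algebras with the componentwise operations. An *internal partially ordered commutative monoid* $(Q,\otimes,k,\le)$ in a topos is a commutative monoid object $(Q,\otimes,k)$ with a relation $\le\,:Q\times Q\to\Omega$ which is, internally, a partial order for which $\otimes$ is monotone in both arguments. For such $Q$ in $\mathcal E$, a $Q$-*span* from $A$ to $B$ is a tuple $(X,\,f:X\to A,\,g:X\to B,\,\chi:X\to Q)$.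 An isomorphism of $Q$-spans is an isomorphism of the apexes commuting with $f,g,\chi$. A $Q$-span between $(\Sigma,E)$-algebras $A$, $B$ is *algebraic* if for every $\sigma\in\Sigma$, of arity $n$, the following holds in the internal language of $\mathcal E$: $$\forall x_1,\dots,x_n\ \exists x.\quad f(x)=\sigma^A(f(x_1),\dots,f(x_n))\ \wedge\ g(x)=\sigma^B(g(x_1),\dots,g(x_n))\ \wedge\ \chi(x_1)\otimes\cdots\otimes\chi(x_n)\le\chi(x)$$ (an empty product is $k$). $\mathbf{Span}^{\mathcal E}_{(\Sigma,E)}(Q)$ is the symmetric monoidal category whose objects are the $(\Sigma,E)$-algebras in $\mathcal E$ and whose morphisms are isomorphism classes of algebraic $Q$-spans. The identity on $A$ is $(A,1,1,\chi_k)$, with $\chi_k:A\to1\xrightarrow{k}Q$. The composite of $(X,f,g,\chi):A\to B$ and $(Y,h,l,\xi):B\to C$ has apex the pullback $X\times_BY$ of $g$ and $h$, the evident legs, and characteristic morphism $X\times_BY\to X\times Y\xrightarrow{\chi\times\xi}Q\times Q\xrightarrow{\otimes}Q$. The tensor product is $A\times B$ on objects and $(X\times Y,\ f\times h,\ g\times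 l,\ \otimes\circ(\chi\times\xi))$ on morphisms, the unit is $1$, and the associator, unitors and symmetry are the graphs $(A,1,f,\chi_k)$ of the canonical isomorphisms $f$ of finite products. For a logical functor $L:\mathcal E\to\mathcal F$, the objects $LA$ (for $A$ a $(\Sigma,E)$-algebra) and $LQ$ carry the structures transported along $L$ and the canonical isomorphisms $L(A^n)\cong(LA)^n$, $L1\cong1$, $L(Q\times Q)\cong LQ\times LQ$, $L\Omega\cong\Omega$; $LA$ is a $(\Sigma,E)$-algebra and $LQ$ an internal partially ordered commutative monoid in $\mathcal F$. Moreover $\mathrm{id}(Q)=Q$ and $(M\circ L)Q=M(LQ)$. **Theorem.** Let $(\Sigma,E)$ be a signature. To every logical functor $L:\mathcal E\to\mathcal F$ between toposes and every internal partially ordered commutative monoid $(Q,\otimes,k,\le)$ in $\mathcal E$ one can assign a (strong) symmetric monoidal functor $$L^*:\mathbf{Span}^{\mathcal E}_{(\Sigma,E)}(Q)\longrightarrow\mathbf{Span}^{\mathcal F}_{(\Sigma,E)}(LQ)$$ given on objects by $A\mapsto LA$ and on morphisms by $[(X,f,g,\chi)]\mapsto[(LX,Lf,Lg,L\chi)]$;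 in particular, the latter spans are algebraic. The assignment $L\mapsto L^*$ is functorial: $(\mathrm{id}_{\mathcal E})^*$ is the identity, and for logical functors $L:\mathcal E\to\mathcal F$ and $M:\mathcal F\to\mathcal G$ $$(M\circ L)^*=M^*\circ L^*:\mathbf{Span}^{\mathcal E}_{(\Sigma,E)}(Q)\longrightarrow\mathbf{Span}^{\mathcal G}_{(\Sigma,E)}(MLQ),$$ as symmetric monoidal functors. -/

import Mathlib

open CategoryTheory Limits MonoidalCategory CartesianMonoidalCategory
open scoped MonObj

universe v u w

/-- An elementary topos: a category with finite limits, exponentials and a subobject classifier.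
A choice of terminal object and binary products (with the induced symmetry) is part of the data. -/
class ElementaryTopos (E : Type u) [Category.{v} E] extends CartesianMonoidalCategory E,
  BraidedCategory E, MonoidalClosed E, HasFiniteLimits E, HasSubobjectClassifier E

namespace QSpans

noncomputable section

/-! ### Algebraic theories and their models in a topos -/

/-- A set of operation symbols of finite arity. -/
structure Operations where
  Op : Type w
  arity : Op → ℕ

/-- Terms in `n` variables. -/
inductive Term (S : Operations.{w}) (n : ℕ) : Type w
  | var (i : Fin n) : Term S n
  | app (σ : S.Op) (ts : Fin (S.arity σ) → Term S n) : Term S n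

/-- An algebraic signature `(Σ, E)`: operations of finite arity, and for each `n` a set of equations
between terms in the `n` variables of a finite context. -/
structure AlgSignature extends Operations.{w} where
  eqns : ∀ n : ℕ, Set (Term toOperations n × Term toOperations n)

variable {E : Type u} [Category.{v} E] [ElementaryTopos E]

/-- The `n`-th power of an object. -/
abbrev pow (X : E) (n : ℕ) : E := ∏ᶜ fun _ : Fin n => X

/-- The tuple `(x₁, …, xₙ)` of generalised elements. -/
abbrev tuple {T X : E} {n : ℕ} (x : Fin n → (T ⟶ X)) : T ⟶ pow X n := Pi.lift x

/-- The value of a term at generalised elements `x₁, …, xₙ : T ⟶ X`. -/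
def termVal {S : Operations.{w}} {X : E} (op : ∀ σ : S.Op, pow X (S.arity σ) ⟶ X) {T : E} {n : ℕ}
    (x : Fin n → (T ⟶ X)) : Term S n → (T ⟶ X)
  | .var i => x i
  | .app σ ts => tuple (fun j => termVal op x (ts j)) ≫ op σ

/-- An internal `(Σ, E)`-algebra. An equation in `n` variables holds when the two derived operations
`Xⁿ ⟶ X`, that is, the values of the two terms at the projections of `Xⁿ`, are equal. -/
structure Algebra (S : AlgSignature.{w}) (E : Type u) [Category.{v} E] [ElementaryTopos E] where
  carrier : E
  op : ∀ σ : S.Op, pow carrier (S.arity σ) ⟶ carrier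
  sat : ∀ (n : ℕ) (p : Term S.toOperations n × Term S.toOperations n), p ∈ S.eqns n →
    termVal op (fun i : Fin n => Pi.π (fun _ : Fin n => carrier) i) p.1 =
      termVal op (fun i : Fin n => Pi.π (fun _ : Fin n => carrier) i) p.2

lemma comp_tuple {T T' X : E} {n : ℕ} (u : T' ⟶ T) (x : Fin n → (T ⟶ X)) :
    u ≫ tuple x = tuple (fun i => u ≫ x i) := by
  ext; simp

lemma comp_tuple_assoc {T T' X Z : E} {n : ℕ} (u : T' ⟶ T) (x : Fin n → (T ⟶ X))
    (f : pow X n ⟶ Z) : u ≫ tuple x ≫ f = tuple (fun i => u ≫ x i) ≫ f := by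
  rw [← Category.assoc, comp_tuple]

lemma comp_termVal {S : Operations.{w}} {X : E} (op : ∀ σ : S.Op, pow X (S.arity σ) ⟶ X)
    {T T' : E} {n : ℕ} (u : T' ⟶ T) (x : Fin n → (T ⟶ X)) (t : Term S n) :
    u ≫ termVal op x t = termVal op (fun i => u ≫ x i) t := by
  induction t with
  | var i => rfl
  | app σ ts ih => simp only [termVal, comp_tuple_assoc, ih]

/-- `f` commutes with all operations. -/
def IsAlgHom {S : Operations.{w}} {X Y : E} (opX : ∀ σ : S.Op, pow X (S.arity σ) ⟶ X)
    (opY : ∀ σ : S.Op, pow Y (S.arity σ) ⟶ Y) (f : X ⟶ Y) : Prop :=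
  ∀ (σ : S.Op) (T : E) (x : Fin (S.arity σ) → (T ⟶ X)),
    (tuple x ≫ opX σ) ≫ f = tuple (fun i => x i ≫ f) ≫ opY σ

lemma termVal_comp {S : Operations.{w}} {X Y : E} {opX : ∀ σ : S.Op, pow X (S.arity σ) ⟶ X}
    {opY : ∀ σ : S.Op, pow Y (S.arity σ) ⟶ Y} {f : X ⟶ Y} (hf : IsAlgHom opX opY f)
    {T : E} {n : ℕ} (x : Fin n → (T ⟶ X)) (t : Term S n) :
    termVal opX x t ≫ f = termVal opY (fun i => x i ≫ f) t := by
  induction t with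
  | var i => rfl
  | app σ ts ih => rw [termVal, termVal, hf σ]; simp only [ih]

namespace Algebra

variable {S : AlgSignature.{w}}

lemma sat_val (A : Algebra S E) {T : E} {n : ℕ} (x : Fin n → (T ⟶ A.carrier))
    (p : Term S.toOperations n × Term S.toOperations n) (hp : p ∈ S.eqns n) :
    termVal A.op x p.1 = termVal A.op x p.2 := by
  have h := congrArg (fun f => tuple x ≫ f) (A.sat n p hp)
  simpa [comp_termVal] using h

/-- The product of two algebras, with componentwise operations. -/
def prodOp (A B : Algebra S E) (σ : S.Op) :
    pow (A.carrier ⊗ B.carrier) (S.arity σ) ⟶ A.carrier ⊗ B.carrier :=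
  lift (tuple (fun i => Pi.π _ i ≫ fst _ _) ≫ A.op σ) (tuple (fun i => Pi.π _ i ≫ snd _ _) ≫ B.op σ)

lemma prodOp_fst (A B : Algebra S E) : IsAlgHom (prodOp A B) A.op (fst _ _) := by
  intro σ T x
  simp [prodOp, comp_tuple_assoc]

lemma prodOp_snd (A B : Algebra S E) : IsAlgHom (prodOp A B) B.op (snd _ _) := by
  intro σ T x
  simp [prodOp, comp_tuple_assoc]

/-- The product of two algebras. -/
abbrev prod (A B : Algebra S E) : Algebra S E where
  carrier := A.carrier ⊗ B.carrier
  op := prodOp A B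
  sat n p hp := by
    apply CartesianMonoidalCategory.hom_ext
    · rw [termVal_comp (prodOp_fst A B), termVal_comp (prodOp_fst A B), A.sat_val _ p hp]
    · rw [termVal_comp (prodOp_snd A B), termVal_comp (prodOp_snd A B), B.sat_val _ p hp]

/-- The terminal algebra. -/
abbrev unit (S : AlgSignature.{w}) (E : Type u) [Category.{v} E] [ElementaryTopos E] :
    Algebra S E where
  carrier := 𝟙_ E
  op _ := toUnit _
  sat _ _ _ := toUnit_unique _ _

/-- Homomorphisms of algebras. -/
def IsHom (A B : Algebra S E) (f : A.carrier ⟶ B.carrier) : Prop := IsAlgHom A.op B.op f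

lemma isHom_id (A : Algebra S E) : IsHom A A (𝟙 _) := by intro σ T x; simp

lemma IsHom.comp {A B C : Algebra S E} {f : A.carrier ⟶ B.carrier} {g : B.carrier ⟶ C.carrier}
    (hf : IsHom A B f) (hg : IsHom B C g) : IsHom A C (f ≫ g) := by
  intro σ T x
  rw [← Category.assoc, hf, hg]; simp

lemma isHom_fst (A B : Algebra S E) : IsHom (prod A B) A (fst _ _) := prodOp_fst A B
lemma isHom_snd (A B : Algebra S E) : IsHom (prod A B) B (snd _ _) := prodOp_snd A B

lemma isHom_toUnit (A : Algebra S E) : IsHom A (unit S E) (toUnit _) :=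
  fun _ _ _ => toUnit_unique _ _

lemma IsHom.lift {A B C : Algebra S E} {f : A.carrier ⟶ B.carrier} {g : A.carrier ⟶ C.carrier}
    (hf : IsHom A B f) (hg : IsHom A C g) :
    IsHom A (prod B C) (CartesianMonoidalCategory.lift f g) := by
  intro σ T x
  apply CartesianMonoidalCategory.hom_ext
  · rw [isHom_fst B C σ T, Category.assoc, lift_fst, hf]; simp
  · rw [isHom_snd B C σ T, Category.assoc, lift_snd, hg]; simp

end Algebra

/-! ### Internal partially ordered commutative monoids -/

/-- The generalised truth value `true : T ⟶ Ω`. -/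
def trueAt (T : E) : T ⟶ HasSubobjectClassifier.Ω E :=
  Subobject.Classifier.χ₀ _ T ≫ HasSubobjectClassifier.truth E

/-- A generalised truth value at stage `T` holds if it is equal to `true`. -/
def Holds {T : E} (p : T ⟶ HasSubobjectClassifier.Ω E) : Prop := p = trueAt T

@[simp]
lemma comp_trueAt {T T' : E} (u : T' ⟶ T) : u ≫ trueAt T = trueAt T' := by
  unfold trueAt
  rw [← Category.assoc]
  congr 1
  exact Subsingleton.elim _ _

lemma Holds.comp {T T' : E} {p : T ⟶ HasSubobjectClassifier.Ω E} (h : Holds p) (u : T' ⟶ T) :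
    Holds (u ≫ p) := by
  rw [Holds, show p = trueAt T from h, comp_trueAt]

/-- An internal partially ordered commutative monoid `(Q, ⊗, k, ≤)`: a commutative monoid object
with an internal relation `≤ : Q × Q ⟶ Ω` that is internally a partial order and for which the
multiplication is monotone. The internal statements are spelled out through generalised elements;
`x * y` is the product of generalised elements of `Q`. -/
structure OrderedCommMonoid (E : Type u) [Category.{v} E] [ElementaryTopos E] extends
    CommMon E where
  le : X ⊗ X ⟶ HasSubobjectClassifier.Ω E
  le_refl : ∀ {T : E} (x : T ⟶ X), Holds (lift x x ≫ le)
  le_trans : ∀ {T : E} (x y z : T ⟶ X),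
    Holds (lift x y ≫ le) → Holds (lift y z ≫ le) → Holds (lift x z ≫ le)
  le_antisymm : ∀ {T : E} (x y : T ⟶ X),
    Holds (lift x y ≫ le) → Holds (lift y x ≫ le) → x = y
  mul_le_mul : ∀ {T : E} (x x' y y' : T ⟶ X),
    Holds (lift x x' ≫ le) → Holds (lift y y' ≫ le) → Holds (lift (x * y) (x' * y') ≫ le)

/-- The order of `Q` on generalised elements. -/
def OrderedCommMonoid.Le (Q : OrderedCommMonoid E) {T : E} (x y : T ⟶ Q.X) : Prop :=
  Holds (lift x y ≫ Q.le)

lemma OrderedCommMonoid.Le.comp {Q : OrderedCommMonoid E} {T T' : E} {x y : T ⟶ Q.X}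
    (h : Q.Le x y) (u : T' ⟶ T) : Q.Le (u ≫ x) (u ≫ y) := by
  have := Holds.comp h u
  rwa [← Category.assoc, CartesianMonoidalCategory.comp_lift] at this

lemma comp_one {Q : OrderedCommMonoid E} {T T' : E} (u : T' ⟶ T) :
    u ≫ (1 : T ⟶ Q.X) = 1 := MonObj.comp_one u

lemma comp_prod {Q : OrderedCommMonoid E} {T T' : E} (u : T' ⟶ T) {n : ℕ}
    (x : Fin n → (T ⟶ Q.X)) : u ≫ ∏ i, x i = ∏ i, u ≫ x i :=
  map_prod (⟨⟨fun f : T ⟶ Q.X => u ≫ f, MonObj.comp_one u⟩, MonObj.comp_mul u⟩ :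
    (T ⟶ Q.X) →* (T' ⟶ Q.X)) x Finset.univ

/-! ### `Q`-spans -/

variable {S : AlgSignature.{w}} {Q : OrderedCommMonoid E}

/-- A `Q`-span from `A` to `B`: a span with a characteristic morphism from the apex to `Q`. -/
structure QSpan (Q : OrderedCommMonoid E) (A B : E) where
  apex : E
  left : apex ⟶ A
  right : apex ⟶ B
  char : apex ⟶ Q.X

namespace QSpan

/-- Isomorphism of `Q`-spans. -/
def IsIsomorphic {A B : E} (s t : QSpan Q A B) : Prop :=
  ∃ e : s.apex ≅ t.apex,
    e.hom ≫ t.left = s.left ∧ e.hom ≫ t.right = s.right ∧ e.hom ≫ t.char = s.char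

lemma IsIsomorphic.refl {A B : E} (s : QSpan Q A B) : IsIsomorphic s s := ⟨Iso.refl _, by simp⟩

lemma IsIsomorphic.symm {A B : E} {s t : QSpan Q A B} (h : IsIsomorphic s t) :
    IsIsomorphic t s := by
  obtain ⟨e, h1, h2, h3⟩ := h
  exact ⟨e.symm, by simp [← h1], by simp [← h2], by simp [← h3]⟩

lemma IsIsomorphic.trans {A B : E} {s t r : QSpan Q A B} (h : IsIsomorphic s t)
    (h' : IsIsomorphic t r) : IsIsomorphic s r := by
  obtain ⟨e, h1, h2, h3⟩ := h
  obtain ⟨e', h1', h2', h3'⟩ := h'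
  exact ⟨e ≪≫ e', by simp [h1, h1'], by simp [h2, h2'], by simp [h3, h3']⟩

/-- The identity span `(A, 1, 1, χ_k)`. -/
abbrev id (Q : OrderedCommMonoid E) (A : E) : QSpan Q A A where
  apex := A
  left := 𝟙 A
  right := 𝟙 A
  char := toUnit A ≫ MonObj.one

/-- The graph `(A, 1, f, χ_k)` of a morphism. -/
abbrev graph (Q : OrderedCommMonoid E) {A B : E} (f : A ⟶ B) : QSpan Q A B where
  apex := A
  left := 𝟙 A
  right := f
  char := toUnit A ≫ MonObj.one

/-- Composition of spans by pullback, with characteristic morphism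
`X ×_B Y ⟶ X × Y ⟶ Q × Q ⟶ Q`. -/
abbrev comp {A B C : E} (s : QSpan Q A B) (t : QSpan Q B C) : QSpan Q A C where
  apex := pullback s.right t.left
  left := pullback.fst s.right t.left ≫ s.left
  right := pullback.snd s.right t.left ≫ t.right
  char := lift (pullback.fst s.right t.left) (pullback.snd s.right t.left) ≫
    (s.char ⊗ₘ t.char) ≫ MonObj.mul

/-- The tensor product of spans, with characteristic morphism `X × Y ⟶ Q × Q ⟶ Q`. -/
abbrev tensor {A B A' B' : E} (s : QSpan Q A B) (t : QSpan Q A' B') : QSpan Q (A ⊗ A') (B ⊗ B') where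
  apex := s.apex ⊗ t.apex
  left := s.left ⊗ₘ t.left
  right := s.right ⊗ₘ t.right
  char := (s.char ⊗ₘ t.char) ≫ MonObj.mul

lemma one_eq {T : E} : toUnit T ≫ MonObj.one (X := Q.X) = 1 := rfl

lemma lift_tensor_mul {T X Y : E} (p : T ⟶ X) (q : T ⟶ Y) (χ : X ⟶ Q.X) (ξ : Y ⟶ Q.X) :
    lift p q ≫ (χ ⊗ₘ ξ) ≫ MonObj.mul = (p ≫ χ) * (q ≫ ξ) := by
  rw [CategoryTheory.Hom.mul_def, lift_map_assoc]

lemma tensor_mul {X Y : E} (χ : X ⟶ Q.X) (ξ : Y ⟶ Q.X) :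
    (χ ⊗ₘ ξ) ≫ MonObj.mul = (fst _ _ ≫ χ) * (snd _ _ ≫ ξ) := by
  rw [CategoryTheory.Hom.mul_def, lift_fst_comp_snd_comp]

/-! Span-level isomorphisms giving the laws of the category of spans. -/

section laws

attribute [local simp] pullback.lift_fst pullback.lift_snd pullback.lift_fst_assoc
  pullback.lift_snd_assoc

variable {A B C D A' B' C' : E}

lemma isIsomorphic_of {X Y : E} {l : X ⟶ A} {r : X ⟶ B} {c : X ⟶ Q.X} {l' : Y ⟶ A} {r' : Y ⟶ B}
    {c' : Y ⟶ Q.X} (f : X ⟶ Y) (g : Y ⟶ X)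
    (hfg : f ≫ g = 𝟙 _) (hgf : g ≫ f = 𝟙 _) (hl : f ≫ l' = l)
    (hr : f ≫ r' = r) (hc : f ≫ c' = c) :
    IsIsomorphic (⟨X, l, r, c⟩ : QSpan Q A B) ⟨Y, l', r', c'⟩ :=
  ⟨⟨f, g, hfg, hgf⟩, hl, hr, hc⟩

lemma comp_congr {s s' : QSpan Q A B} {t t' : QSpan Q B C} (h : IsIsomorphic s s')
    (h' : IsIsomorphic t t') : IsIsomorphic (s.comp t) (s'.comp t') := by
  obtain ⟨X, f, g, χ⟩ := s
  obtain ⟨X', f', g', χ'⟩ := s'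
  obtain ⟨Y, m, n, ξ⟩ := t
  obtain ⟨Y', m', n', ξ'⟩ := t'
  obtain ⟨e, h1, h2, h3⟩ := h
  obtain ⟨e', h1', h2', h3'⟩ := h'
  dsimp only at e h1 h2 h3 e' h1' h2' h3'
  have k1 : e.inv ≫ g = g' := by simp [← h2]
  have k2 : e'.inv ≫ m = m' := by simp [← h1']
  dsimp only [comp]
  refine isIsomorphic_of
    (pullback.lift (pullback.fst _ _ ≫ e.hom) (pullback.snd _ _ ≫ e'.hom)
      (by simp [h2, h1', pullback.condition]))
    (pullback.lift (pullback.fst _ _ ≫ e.inv) (pullback.snd _ _ ≫ e'.inv)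
      (by simp [k1, k2, pullback.condition])) ?_ ?_ ?_ ?_ ?_
  · apply pullback.hom_ext <;> simp
  · apply pullback.hom_ext <;> simp
  · simp [h1]
  · simp [h2']
  · simp only [lift_tensor_mul, MonObj.comp_mul, pullback.lift_fst_assoc, pullback.lift_snd_assoc,
      Category.assoc, h3, h3']

lemma id_comp (s : QSpan Q A B) : IsIsomorphic ((QSpan.id Q A).comp s) s := by
  obtain ⟨X, f, g, χ⟩ := s
  dsimp only [comp, QSpan.id]
  have c := pullback.condition (f := 𝟙 A) (g := f)
  rw [Category.comp_id] at c
  refine isIsomorphic_of (pullback.snd _ _) (pullback.lift f (𝟙 _) (by simp)) ?_ ?_ ?_ ?_ ?_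
  · apply pullback.hom_ext <;> simp [c]
  · simp
  · simp [c]
  · rfl
  · simp only [lift_tensor_mul, one_eq, comp_one, one_mul]

lemma comp_id (s : QSpan Q A B) : IsIsomorphic (s.comp (QSpan.id Q B)) s := by
  obtain ⟨X, f, g, χ⟩ := s
  dsimp only [comp, QSpan.id]
  have c := pullback.condition (f := g) (g := 𝟙 B)
  rw [Category.comp_id] at c
  refine isIsomorphic_of (pullback.fst _ _) (pullback.lift (𝟙 _) g (by simp)) ?_ ?_ ?_ ?_ ?_
  · apply pullback.hom_ext <;> simp [c]
  · simp
  · rfl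
  · simp [c]
  · simp only [lift_tensor_mul, one_eq, comp_one, mul_one]

lemma comp_assoc (s : QSpan Q A B) (t : QSpan Q B C) (r : QSpan Q C D) :
    IsIsomorphic ((s.comp t).comp r) (s.comp (t.comp r)) := by
  obtain ⟨X, f, g, χ⟩ := s
  obtain ⟨Y, m, n, ξ⟩ := t
  obtain ⟨Z, p, q, ζ⟩ := r
  dsimp only [comp]
  have c1 := pullback.condition (f := pullback.snd g m ≫ n) (g := p)
  have c2 := pullback.condition (f := g) (g := pullback.fst n p ≫ m)
  refine isIsomorphic_of
    (pullback.lift (pullback.fst _ _ ≫ pullback.fst _ _)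
      (pullback.lift (pullback.fst _ _ ≫ pullback.snd _ _) (pullback.snd _ _)
        (by rw [Category.assoc]; exact c1)) ?_)
    (pullback.lift
      (pullback.lift (pullback.fst _ _) (pullback.snd _ _ ≫ pullback.fst _ _)
        (by rw [Category.assoc]; exact c2))
      (pullback.snd _ _ ≫ pullback.snd _ _) ?_) ?_ ?_ ?_ ?_ ?_
  · rw [pullback.lift_fst_assoc, Category.assoc, Category.assoc, pullback.condition]
  · rw [pullback.lift_snd_assoc, Category.assoc, Category.assoc, pullback.condition]
  · apply pullback.hom_ext
    · apply pullback.hom_ext <;> simp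
    · simp
  · apply pullback.hom_ext
    · simp
    · apply pullback.hom_ext <;> simp
  · simp
  · simp
  · simp only [lift_tensor_mul, MonObj.comp_mul, pullback.lift_fst_assoc, pullback.lift_snd_assoc,
      Category.assoc, mul_assoc]

lemma tensor_congr {s s' : QSpan Q A B} {t t' : QSpan Q A' B'} (h : IsIsomorphic s s')
    (h' : IsIsomorphic t t') : IsIsomorphic (s.tensor t) (s'.tensor t') := by
  obtain ⟨e, h1, h2, h3⟩ := h
  obtain ⟨e', h1', h2', h3'⟩ := h'
  dsimp only [tensor]
  refine isIsomorphic_of (e.hom ⊗ₘ e'.hom) (e.inv ⊗ₘ e'.inv) (by simp) (by simp)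
    (by simp [h1, h1']) (by simp [h2, h2']) ?_
  simp only [tensor_mul, MonObj.comp_mul, tensorHom_fst_assoc, tensorHom_snd_assoc, h3, h3']

lemma tensor_id : IsIsomorphic ((QSpan.id Q A).tensor (QSpan.id Q A')) (QSpan.id Q (A ⊗ A')) := by
  dsimp only [tensor, QSpan.id]
  refine isIsomorphic_of (𝟙 _) (𝟙 _) (by simp) (by simp) (by simp) (by simp) ?_
  simp only [tensor_mul, one_eq, comp_one, one_mul]

lemma tensor_comp (s : QSpan Q A B) (t : QSpan Q B C) (s' : QSpan Q A' B') (t' : QSpan Q B' C') :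
    IsIsomorphic ((s.comp t).tensor (s'.comp t')) ((s.tensor s').comp (t.tensor t')) := by
  obtain ⟨X, f, g, χ⟩ := s
  obtain ⟨Y, m, n, ξ⟩ := t
  obtain ⟨X', f', g', χ'⟩ := s'
  obtain ⟨Y', m', n', ξ'⟩ := t'
  dsimp only [comp, tensor]
  have c := pullback.condition (f := g ⊗ₘ g') (g := m ⊗ₘ m')
  have c1 : (pullback.fst (g ⊗ₘ g') (m ⊗ₘ m') ≫ fst _ _) ≫ g =
      (pullback.snd (g ⊗ₘ g') (m ⊗ₘ m') ≫ fst _ _) ≫ m := by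
    simpa using c =≫ fst _ _
  have c2 : (pullback.fst (g ⊗ₘ g') (m ⊗ₘ m') ≫ snd _ _) ≫ g' =
      (pullback.snd (g ⊗ₘ g') (m ⊗ₘ m') ≫ snd _ _) ≫ m' := by
    simpa using c =≫ snd _ _
  refine isIsomorphic_of
    (pullback.lift (pullback.fst _ _ ⊗ₘ pullback.fst _ _) (pullback.snd _ _ ⊗ₘ pullback.snd _ _)
      (by simp [pullback.condition]))
    (lift (pullback.lift _ _ c1) (pullback.lift _ _ c2)) ?_ ?_ ?_ ?_ ?_
  · apply CartesianMonoidalCategory.hom_ext <;> apply pullback.hom_ext <;> simp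
  · apply pullback.hom_ext <;> apply CartesianMonoidalCategory.hom_ext <;> simp
  · simp
  · simp
  · simp only [tensor_mul, MonObj.comp_mul, pullback.lift_fst_assoc,
      pullback.lift_snd_assoc, tensorHom_fst_assoc, tensorHom_snd_assoc, lift_fst_assoc,
      lift_snd_assoc]
    rw [mul_mul_mul_comm]

lemma graph_comp (f : A ⟶ B) (g : B ⟶ C) :
    IsIsomorphic ((graph Q f).comp (graph Q g)) (graph Q (f ≫ g)) := by
  dsimp only [comp, graph]
  have c := pullback.condition (f := f) (g := 𝟙 B)
  rw [Category.comp_id] at c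
  refine isIsomorphic_of (pullback.fst _ _) (pullback.lift (𝟙 _) f (by simp)) ?_ (by simp) ?_ ?_ ?_
  · apply pullback.hom_ext <;> simp [c]
  · rfl
  · simp [← c]
  · simp only [lift_tensor_mul, one_eq, comp_one, one_mul]

lemma graph_tensor (f : A ⟶ B) (g : A' ⟶ B') :
    IsIsomorphic ((graph Q f).tensor (graph Q g)) (graph Q (f ⊗ₘ g)) := by
  dsimp only [tensor, graph]
  refine isIsomorphic_of (𝟙 _) (𝟙 _) (by simp) (by simp) (by simp) (by simp) ?_
  simp only [tensor_mul, one_eq, comp_one, one_mul]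

/-- A square of spans whose vertical sides are graphs commutes as soon as there is a compatible
isomorphism of apexes. -/
lemma graph_naturality (s : QSpan Q A B) (s' : QSpan Q A' B') (f : A ≅ A') (g : B ⟶ B')
    (φ : s.apex ≅ s'.apex) (hl : φ.hom ≫ s'.left = s.left ≫ f.hom)
    (hr : φ.hom ≫ s'.right = s.right ≫ g) (hc : φ.hom ≫ s'.char = s.char) :
    IsIsomorphic (s.comp (graph Q g)) ((graph Q f.hom).comp s') := by
  obtain ⟨X, l, r, χ⟩ := s
  obtain ⟨X', l', r', χ'⟩ := s'
  dsimp only at φ hl hr hc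
  have hl' : φ.inv ≫ l = l' ≫ f.inv := by
    rw [Iso.inv_comp_eq, ← Category.assoc, hl]; simp
  have i1 : IsIsomorphic ((⟨X, l, r, χ⟩ : QSpan Q A B).comp (graph Q g)) ⟨X, l, r ≫ g, χ⟩ := by
    dsimp only [comp, graph]
    have c1 := pullback.condition (f := r) (g := 𝟙 B)
    rw [Category.comp_id] at c1
    refine isIsomorphic_of (pullback.fst _ _) (pullback.lift (𝟙 _) r (by simp))
      ?_ (by simp) rfl ?_ ?_
    · apply pullback.hom_ext <;> simp [c1]
    · simp [← c1]
    · simp only [lift_tensor_mul, one_eq, comp_one, mul_one]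
  have i2 : IsIsomorphic ((graph Q f.hom).comp ⟨X', l', r', χ'⟩) ⟨X, l, r ≫ g, χ⟩ := by
    dsimp only [comp, graph]
    have c2 := pullback.condition (f := f.hom) (g := l')
    refine isIsomorphic_of (pullback.snd _ _ ≫ φ.inv) (pullback.lift l φ.hom hl.symm)
      ?_ (by simp) ?_ ?_ ?_
    · apply pullback.hom_ext
      · simp only [Category.assoc, pullback.lift_fst, Category.id_comp]
        rw [hl', ← Category.assoc, ← c2]; simp
      · simp
    · simp only [Category.assoc, Category.comp_id]
      rw [hl', ← Category.assoc, ← c2]; simp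
    · rw [Category.assoc, ← hr]; simp
    · simp only [lift_tensor_mul, one_eq, comp_one, one_mul, Category.assoc, ← hc,
        Iso.inv_hom_id_assoc]
  exact i1.trans i2.symm

end laws

end QSpan

/-! ### Algebraic `Q`-spans -/

/-- A `Q`-span between `(Σ, E)`-algebras is algebraic if, for every operation `σ` of arity `n`,
internally
`∀ x₁ … xₙ, ∃ x, f x = σ (f x₁, …, f xₙ) ∧ g x = σ (g x₁, …, g xₙ) ∧ χ x₁ ⊗ ⋯ ⊗ χ xₙ ≤ χ x`.
The internal statement is spelled out through the Kripke–Joyal semantics of the topos: at each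
stage `T` and for all generalised elements `x₁, …, xₙ` at that stage, there are an epimorphism
`e : T' ⟶ T` and a generalised element `y` at stage `T'` with the property. -/
def IsAlgebraic (A B : Algebra S E) (s : QSpan Q A.carrier B.carrier) : Prop :=
  ∀ (σ : S.Op) (T : E) (x : Fin (S.arity σ) → (T ⟶ s.apex)),
    ∃ (T' : E) (e : T' ⟶ T) (_ : Epi e) (y : T' ⟶ s.apex),
      y ≫ s.left = e ≫ tuple (fun i => x i ≫ s.left) ≫ A.op σ ∧
      y ≫ s.right = e ≫ tuple (fun i => x i ≫ s.right) ≫ B.op σ ∧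
      Q.Le (e ≫ ∏ i, x i ≫ s.char) (y ≫ s.char)

namespace IsAlgebraic

variable {A B C A' B' C' : Algebra S E}

lemma of_iso {s t : QSpan Q A.carrier B.carrier} (hs : IsAlgebraic A B s)
    (h : QSpan.IsIsomorphic s t) : IsAlgebraic A B t := by
  obtain ⟨φ, h1, h2, h3⟩ := h
  intro σ T x
  obtain ⟨T', e, he, y, k1, k2, k3⟩ := hs σ T (fun i => x i ≫ φ.inv)
  have h1' : φ.inv ≫ s.left = t.left := by rw [Iso.inv_comp_eq, h1]
  have h2' : φ.inv ≫ s.right = t.right := by rw [Iso.inv_comp_eq, h2]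
  have h3' : φ.inv ≫ s.char = t.char := by rw [Iso.inv_comp_eq, h3]
  refine ⟨T', e, he, y ≫ φ.hom, ?_, ?_, ?_⟩
  · rw [Category.assoc, h1, k1]; simp only [Category.assoc, h1']
  · rw [Category.assoc, h2, k2]; simp only [Category.assoc, h2']
  · rw [Category.assoc, h3]; simpa only [Category.assoc, h3'] using k3

lemma le_of_eq {T : E} {x y : T ⟶ Q.X} (h : x = y) : Q.Le x y := h ▸ Q.le_refl x

lemma graph {f : A.carrier ⟶ B.carrier} (hf : Algebra.IsHom A B f) :
    IsAlgebraic A B (QSpan.graph Q f) := by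
  intro σ T x
  refine ⟨T, 𝟙 T, inferInstance, tuple x ≫ A.op σ, ?_, ?_, ?_⟩
  · simp
  · simpa using hf σ T x
  · apply le_of_eq
    simp [QSpan.one_eq]

lemma id (A : Algebra S E) : IsAlgebraic A A (QSpan.id Q A.carrier) :=
  graph (Algebra.isHom_id A)

lemma comp {s : QSpan Q A.carrier B.carrier} {t : QSpan Q B.carrier C.carrier}
    (hs : IsAlgebraic A B s) (ht : IsAlgebraic B C t) : IsAlgebraic A C (s.comp t) := by
  intro σ T x
  dsimp only [QSpan.comp] at x ⊢
  obtain ⟨T₁, e₁, he₁, y₁, k1, k2, k3⟩ := hs σ T (fun i => x i ≫ pullback.fst _ _)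
  obtain ⟨T₂, e₂, he₂, y₂, l1, l2, l3⟩ := ht σ T₁ (fun i => e₁ ≫ x i ≫ pullback.snd _ _)
  simp only [Category.assoc] at k1 k2 k3 l1 l2 l3
  have hc : (e₂ ≫ y₁) ≫ s.right = y₂ ≫ t.left := by
    have c : ∀ i, x i ≫ pullback.fst _ _ ≫ s.right = x i ≫ pullback.snd _ _ ≫ t.left :=
      fun i => congrArg (x i ≫ ·) pullback.condition
    rw [l1, Category.assoc, k2]
    simp only [c, comp_tuple_assoc]
  refine ⟨T₂, e₂ ≫ e₁, inferInstance, pullback.lift (e₂ ≫ y₁) y₂ hc, ?_, ?_, ?_⟩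
  · rw [pullback.lift_fst_assoc, Category.assoc, k1]
    simp only [Category.assoc]
  · rw [pullback.lift_snd_assoc, l2]
    simp only [Category.assoc, comp_tuple_assoc]
  · simp only [QSpan.lift_tensor_mul, MonObj.comp_mul, pullback.lift_fst_assoc,
      pullback.lift_snd_assoc, Category.assoc, Finset.prod_mul_distrib]
    simp only [← comp_prod] at l3
    exact Q.mul_le_mul _ _ _ _ (k3.comp e₂) l3

lemma tensor {s : QSpan Q A.carrier B.carrier} {t : QSpan Q A'.carrier B'.carrier}
    (hs : IsAlgebraic A B s) (ht : IsAlgebraic A' B' t) :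
    IsAlgebraic (A.prod A') (B.prod B') (s.tensor t) := by
  intro σ T x
  dsimp only [QSpan.tensor] at x ⊢
  obtain ⟨T₁, e₁, he₁, y₁, k1, k2, k3⟩ := hs σ T (fun i => x i ≫ fst _ _)
  obtain ⟨T₂, e₂, he₂, y₂, l1, l2, l3⟩ := ht σ T₁ (fun i => e₁ ≫ x i ≫ snd _ _)
  simp only [Category.assoc] at k1 k2 k3 l1 l2 l3
  refine ⟨T₂, e₂ ≫ e₁, inferInstance, lift (e₂ ≫ y₁) y₂, ?_, ?_, ?_⟩
  · apply CartesianMonoidalCategory.hom_ext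
    · have h := Algebra.isHom_fst A A' σ T (fun i => x i ≫ (s.left ⊗ₘ t.left))
      simp only [Category.assoc, tensorHom_fst] at h
      simp only [Category.assoc, tensorHom_fst, lift_fst_assoc, k1, h]
    · have h := Algebra.isHom_snd A A' σ T (fun i => x i ≫ (s.left ⊗ₘ t.left))
      simp only [Category.assoc, tensorHom_snd] at h
      simp only [Category.assoc, tensorHom_snd, lift_snd_assoc, l1, h]
      simp only [comp_tuple_assoc]
  · apply CartesianMonoidalCategory.hom_ext
    · have h := Algebra.isHom_fst B B' σ T (fun i => x i ≫ (s.right ⊗ₘ t.right))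
      simp only [Category.assoc, tensorHom_fst] at h
      simp only [Category.assoc, tensorHom_fst, lift_fst_assoc, k2, h]
    · have h := Algebra.isHom_snd B B' σ T (fun i => x i ≫ (s.right ⊗ₘ t.right))
      simp only [Category.assoc, tensorHom_snd] at h
      simp only [Category.assoc, tensorHom_snd, lift_snd_assoc, l2, h]
      simp only [comp_tuple_assoc]
  · simp only [QSpan.tensor_mul, MonObj.comp_mul, lift_fst_assoc,
      lift_snd_assoc, Category.assoc, Finset.prod_mul_distrib]
    simp only [← comp_prod] at l3
    exact Q.mul_le_mul _ _ _ _ (k3.comp e₂) l3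

end IsAlgebraic

/-- The objects of the category of algebraic `Q`-spans: internal `(Σ, E)`-algebras. -/
structure SpanCat (S : AlgSignature.{w}) {E : Type u} [Category.{v} E] [ElementaryTopos E]
    (Q : OrderedCommMonoid E) where
  alg : Algebra S E

/-- Algebraic `Q`-spans. -/
def AlgSpan (Q : OrderedCommMonoid E) (A B : Algebra S E) :=
  {s : QSpan Q A.carrier B.carrier // IsAlgebraic A B s}

instance AlgSpan.setoid (Q : OrderedCommMonoid E) (A B : Algebra S E) :
    Setoid (AlgSpan Q A B) where
  r s t := QSpan.IsIsomorphic s.1 t.1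
  iseqv := ⟨fun s => .refl s.1, fun h => h.symm, fun h h' => h.trans h'⟩

namespace SpanCat

/-- Morphisms are isomorphism classes of algebraic `Q`-spans. -/
def Hom (A B : SpanCat S Q) := Quotient (AlgSpan.setoid Q A.alg B.alg)

/-- The isomorphism class of an algebraic span, as a morphism. -/
def homMk {A B : SpanCat S Q} (s : QSpan Q A.alg.carrier B.alg.carrier)
    (h : IsAlgebraic A.alg B.alg s) : Hom A B := Quotient.mk _ ⟨s, h⟩

lemma homMk_eq {A B : SpanCat S Q} {s t : QSpan Q A.alg.carrier B.alg.carrier}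
    {h : IsAlgebraic A.alg B.alg s} {h' : IsAlgebraic A.alg B.alg t}
    (e : QSpan.IsIsomorphic s t) : homMk s h = homMk t h' := Quotient.sound e

lemma homMk_surj {A B : SpanCat S Q} (f : Hom A B) : ∃ s h, f = homMk s h := by
  obtain ⟨⟨s, h⟩, rfl⟩ := Quotient.exists_rep f
  exact ⟨s, h, rfl⟩

/-- Composition of isomorphism classes of spans. -/
def homComp {A B C : SpanCat S Q} (f : Hom A B) (g : Hom B C) : Hom A C :=
  Quotient.map₂ (fun s t => (⟨s.1.comp t.1, s.2.comp t.2⟩ : AlgSpan Q A.alg C.alg))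
    (fun _ _ h _ _ h' => QSpan.comp_congr h h') f g

instance : Category (SpanCat S Q) where
  Hom := Hom
  id A := homMk (QSpan.id Q A.alg.carrier) (.id _)
  comp := homComp
  id_comp f := by
    obtain ⟨s, h, rfl⟩ := homMk_surj f
    exact homMk_eq (QSpan.id_comp s)
  comp_id f := by
    obtain ⟨s, h, rfl⟩ := homMk_surj f
    exact homMk_eq (QSpan.comp_id s)
  assoc f g k := by
    obtain ⟨s, h, rfl⟩ := homMk_surj f
    obtain ⟨t, h', rfl⟩ := homMk_surj g
    obtain ⟨r, h'', rfl⟩ := homMk_surj k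
    exact homMk_eq (QSpan.comp_assoc s t r)

/-- The morphism represented by an algebraic span. -/
def ofSpan {A B : SpanCat S Q} (s : QSpan Q A.alg.carrier B.alg.carrier)
    (h : IsAlgebraic A.alg B.alg s) : A ⟶ B := homMk s h

lemma ofSpan_eq {A B : SpanCat S Q} {s t : QSpan Q A.alg.carrier B.alg.carrier}
    {h : IsAlgebraic A.alg B.alg s} {h' : IsAlgebraic A.alg B.alg t}
    (e : QSpan.IsIsomorphic s t) : ofSpan s h = ofSpan t h' := Quotient.sound e

lemma ofSpan_surj {A B : SpanCat S Q} (f : A ⟶ B) : ∃ s h, f = ofSpan s h := homMk_surj f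

lemma id_def (A : SpanCat S Q) : 𝟙 A = ofSpan (QSpan.id Q A.alg.carrier) (.id _) := rfl

lemma ofSpan_comp {A B C : SpanCat S Q} {s : QSpan Q A.alg.carrier B.alg.carrier}
    {t : QSpan Q B.alg.carrier C.alg.carrier} (h : IsAlgebraic A.alg B.alg s)
    (h' : IsAlgebraic B.alg C.alg t) : ofSpan s h ≫ ofSpan t h' = ofSpan (s.comp t) (h.comp h') := rfl

/-- The tensor product of isomorphism classes of spans. -/
def homTensor {A B A' B' : SpanCat S Q} (f : A ⟶ B) (g : A' ⟶ B') :
    (⟨A.alg.prod A'.alg⟩ : SpanCat S Q) ⟶ ⟨B.alg.prod B'.alg⟩ :=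
  Quotient.map₂
    (fun s t => (⟨s.1.tensor t.1, s.2.tensor t.2⟩ :
      AlgSpan Q (A.alg.prod A'.alg) (B.alg.prod B'.alg)))
    (fun _ _ h _ _ h' => QSpan.tensor_congr h h') f g

/-- The morphism given by the graph of a homomorphism. -/
def graph {A B : SpanCat S Q} (f : A.alg.carrier ⟶ B.alg.carrier)
    (hf : Algebra.IsHom A.alg B.alg f) : A ⟶ B := ofSpan (QSpan.graph Q f) (.graph hf)

lemma graph_comp {A B C : SpanCat S Q} {f : A.alg.carrier ⟶ B.alg.carrier}
    (hf : Algebra.IsHom A.alg B.alg f) {g : B.alg.carrier ⟶ C.alg.carrier}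
    (hg : Algebra.IsHom B.alg C.alg g) : graph f hf ≫ graph g hg = graph (f ≫ g) (hf.comp hg) :=
  ofSpan_eq (QSpan.graph_comp f g)

lemma graph_id (A : SpanCat S Q) : graph (A := A) (𝟙 _) (Algebra.isHom_id _) = 𝟙 A := rfl

/-- The isomorphism given by the graph of an isomorphism of algebras. -/
def graphIso {A B : SpanCat S Q} (f : A.alg.carrier ≅ B.alg.carrier)
    (hf : Algebra.IsHom A.alg B.alg f.hom) (hg : Algebra.IsHom B.alg A.alg f.inv) : A ≅ B where
  hom := graph f.hom hf
  inv := graph f.inv hg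
  hom_inv_id := by simp only [graph_comp, Iso.hom_inv_id, graph_id]
  inv_hom_id := by simp only [graph_comp, Iso.inv_hom_id, graph_id]

end SpanCat

namespace Algebra

lemma IsHom.inv {A B : Algebra S E} {f : A.carrier ≅ B.carrier} (hf : IsHom A B f.hom) :
    IsHom B A f.inv := by
  intro σ T x
  have h := hf σ T (fun i => x i ≫ f.inv)
  simp only [Category.assoc, Iso.inv_hom_id, Category.comp_id] at h
  rw [← h]
  simp

lemma isHom_associator (A B C : Algebra S E) :
    IsHom ((A.prod B).prod C) (A.prod (B.prod C)) (α_ A.carrier B.carrier C.carrier).hom := by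
  have h : (α_ A.carrier B.carrier C.carrier).hom =
      CartesianMonoidalCategory.lift (fst _ _ ≫ fst _ _)
        (CartesianMonoidalCategory.lift (fst _ _ ≫ snd _ _) (snd _ _)) := by
    ext <;> simp
  rw [h]
  exact ((isHom_fst (A.prod B) C).comp (isHom_fst A B)).lift
    (((isHom_fst (A.prod B) C).comp (isHom_snd A B)).lift (isHom_snd (A.prod B) C))

lemma isHom_leftUnitor (A : Algebra S E) :
    IsHom ((unit S E).prod A) A (λ_ A.carrier).hom := by
  rw [leftUnitor_hom]
  exact isHom_snd (unit S E) A

lemma isHom_rightUnitor (A : Algebra S E) :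
    IsHom (A.prod (unit S E)) A (ρ_ A.carrier).hom := by
  rw [rightUnitor_hom]
  exact isHom_fst A (unit S E)

lemma isHom_braiding (A B : Algebra S E) :
    IsHom (A.prod B) (B.prod A) (β_ A.carrier B.carrier).hom := by
  have h : (β_ A.carrier B.carrier).hom = CartesianMonoidalCategory.lift (snd _ _) (fst _ _) := by
    ext <;> simp
  rw [h]
  exact (isHom_snd A B).lift (isHom_fst A B)

lemma IsHom.tensor {A B A' B' : Algebra S E} {f : A.carrier ⟶ B.carrier}
    {g : A'.carrier ⟶ B'.carrier} (hf : IsHom A B f) (hg : IsHom A' B' g) :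
    IsHom (A.prod A') (B.prod B') (f ⊗ₘ g) := by
  have h : f ⊗ₘ g = CartesianMonoidalCategory.lift (fst _ _ ≫ f) (snd _ _ ≫ g) := by
    ext <;> simp
  rw [h]
  exact ((isHom_fst A A').comp hf).lift ((isHom_snd A A').comp hg)

end Algebra

namespace SpanCat

/-- The monoidal structure is inherited from the finite products of the topos: on objects it is the
product of algebras, on morphisms the tensor product of spans, and the structure isomorphisms are
the graphs of the canonical isomorphisms of products. -/
instance : MonoidalCategoryStruct (SpanCat S Q) where
  tensorObj A B := ⟨A.alg.prod B.alg⟩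
  whiskerLeft A _ _ f := homTensor (𝟙 A) f
  whiskerRight f B := homTensor f (𝟙 B)
  tensorHom f g := homTensor f g
  tensorUnit := ⟨Algebra.unit S E⟩
  associator A B C := graphIso (A := ⟨(A.alg.prod B.alg).prod C.alg⟩)
    (B := ⟨A.alg.prod (B.alg.prod C.alg)⟩)
    (α_ A.alg.carrier B.alg.carrier C.alg.carrier) (Algebra.isHom_associator _ _ _)
    (Algebra.isHom_associator _ _ _).inv
  leftUnitor A := graphIso (A := ⟨(Algebra.unit S E).prod A.alg⟩) (λ_ A.alg.carrier)
    (Algebra.isHom_leftUnitor _) (Algebra.isHom_leftUnitor _).inv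
  rightUnitor A := graphIso (A := ⟨A.alg.prod (Algebra.unit S E)⟩) (ρ_ A.alg.carrier)
    (Algebra.isHom_rightUnitor _) (Algebra.isHom_rightUnitor _).inv

lemma tensor_ofSpan {A B A' B' : SpanCat S Q} {s : QSpan Q A.alg.carrier B.alg.carrier}
    {t : QSpan Q A'.alg.carrier B'.alg.carrier} (h : IsAlgebraic A.alg B.alg s)
    (h' : IsAlgebraic A'.alg B'.alg t) :
    ofSpan s h ⊗ₘ ofSpan t h' =
      ofSpan (A := A ⊗ A') (B := B ⊗ B') (s.tensor t) (h.tensor h') := rfl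

lemma graph_tensor {A B A' B' : SpanCat S Q} {f : A.alg.carrier ⟶ B.alg.carrier}
    (hf : Algebra.IsHom A.alg B.alg f) {g : A'.alg.carrier ⟶ B'.alg.carrier}
    (hg : Algebra.IsHom A'.alg B'.alg g) :
    graph f hf ⊗ₘ graph g hg = graph (A := A ⊗ A') (B := B ⊗ B') (f ⊗ₘ g) (hf.tensor hg) :=
  ofSpan_eq (QSpan.graph_tensor f g)

lemma associator_hom_eq (A B C : SpanCat S Q) :
    (α_ A B C).hom = graph (A := (A ⊗ B) ⊗ C) (B := A ⊗ (B ⊗ C))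
      (α_ A.alg.carrier B.alg.carrier C.alg.carrier).hom (Algebra.isHom_associator _ _ _) := rfl

lemma associator_inv_eq (A B C : SpanCat S Q) :
    (α_ A B C).inv = graph (A := A ⊗ (B ⊗ C)) (B := (A ⊗ B) ⊗ C)
      (α_ A.alg.carrier B.alg.carrier C.alg.carrier).inv (Algebra.isHom_associator _ _ _).inv := rfl

lemma leftUnitor_hom_eq (A : SpanCat S Q) :
    (λ_ A).hom = graph (A := 𝟙_ _ ⊗ A) (λ_ A.alg.carrier).hom (Algebra.isHom_leftUnitor _) := rfl

lemma rightUnitor_hom_eq (A : SpanCat S Q) :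
    (ρ_ A).hom = graph (A := A ⊗ 𝟙_ _) (ρ_ A.alg.carrier).hom (Algebra.isHom_rightUnitor _) := rfl

instance : MonoidalCategory (SpanCat S Q) := MonoidalCategory.ofTensorHom
  (id_tensorHom_id := fun _ _ => ofSpan_eq QSpan.tensor_id)
  (id_tensorHom := fun _ _ _ _ => rfl)
  (tensorHom_id := fun _ _ => rfl)
  (tensorHom_comp_tensorHom := fun f g k l => by
    obtain ⟨s, hs, rfl⟩ := ofSpan_surj f
    obtain ⟨s', hs', rfl⟩ := ofSpan_surj g
    obtain ⟨t, ht, rfl⟩ := ofSpan_surj k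
    obtain ⟨t', ht', rfl⟩ := ofSpan_surj l
    exact ofSpan_eq (QSpan.tensor_comp s t s' t').symm)
  (associator_naturality := fun {A₁ A₂ A₃ B₁ B₂ B₃} f g k => by
    obtain ⟨s, hs, rfl⟩ := ofSpan_surj f
    obtain ⟨t, ht, rfl⟩ := ofSpan_surj g
    obtain ⟨r, hr, rfl⟩ := ofSpan_surj k
    refine ofSpan_eq (QSpan.graph_naturality ((s.tensor t).tensor r) (s.tensor (t.tensor r))
      (α_ A₁.alg.carrier A₂.alg.carrier A₃.alg.carrier)
      (α_ B₁.alg.carrier B₂.alg.carrier B₃.alg.carrier).hom (α_ _ _ _)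
      (MonoidalCategory.associator_naturality _ _ _).symm
      (MonoidalCategory.associator_naturality _ _ _).symm ?_)
    simp only [QSpan.tensor_mul, MonObj.comp_mul, associator_hom_fst_assoc,
      associator_hom_snd_fst_assoc, associator_hom_snd_snd_assoc, mul_assoc])
  (leftUnitor_naturality := fun {A B} f => by
    obtain ⟨s, hs, rfl⟩ := ofSpan_surj f
    refine ofSpan_eq (QSpan.graph_naturality ((QSpan.id Q (𝟙_ E)).tensor s) s
      (λ_ A.alg.carrier) (λ_ B.alg.carrier).hom (λ_ _) ?_ ?_ ?_)
    · simp
    · simp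
    · simp only [QSpan.tensor_mul, QSpan.one_eq, comp_one, one_mul, leftUnitor_hom])
  (rightUnitor_naturality := fun {A B} f => by
    obtain ⟨s, hs, rfl⟩ := ofSpan_surj f
    refine ofSpan_eq (QSpan.graph_naturality (s.tensor (QSpan.id Q (𝟙_ E))) s
      (ρ_ A.alg.carrier) (ρ_ B.alg.carrier).hom (ρ_ _) ?_ ?_ ?_)
    · simp
    · simp
    · simp only [QSpan.tensor_mul, QSpan.one_eq, comp_one, mul_one, rightUnitor_hom])
  (pentagon := fun W X Y Z => by
    simp only [associator_hom_eq, ← graph_id, graph_tensor, graph_comp]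
    congr 1
    simp only [MonoidalCategory.tensorHom_id, MonoidalCategory.id_tensorHom]
    exact MonoidalCategory.pentagon _ _ _ _)
  (triangle := fun X Y => by
    simp only [associator_hom_eq, leftUnitor_hom_eq, rightUnitor_hom_eq, ← graph_id, graph_tensor,
      graph_comp]
    congr 1
    simp only [MonoidalCategory.tensorHom_id, MonoidalCategory.id_tensorHom]
    exact MonoidalCategory.triangle _ _)

/-- The braiding is the graph of the symmetry of the products. -/
instance : SymmetricCategory (SpanCat S Q) where
  braiding A B := graphIso (A := A ⊗ B) (B := B ⊗ A) (β_ A.alg.carrier B.alg.carrier)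
    (Algebra.isHom_braiding _ _) (Algebra.isHom_braiding _ _).inv
  braiding_naturality_right A B C f := by
    obtain ⟨s, hs, rfl⟩ := ofSpan_surj f
    refine ofSpan_eq (QSpan.graph_naturality ((QSpan.id Q A.alg.carrier).tensor s)
      (s.tensor (QSpan.id Q A.alg.carrier))
      (β_ A.alg.carrier B.alg.carrier) (β_ A.alg.carrier C.alg.carrier).hom (β_ _ _) ?_ ?_ ?_)
    · simp
    · simp
    · simp only [QSpan.tensor_mul, MonObj.comp_mul, braiding_hom_fst_assoc, braiding_hom_snd_assoc]
      rw [mul_comm]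
  braiding_naturality_left {A B} f C := by
    obtain ⟨s, hs, rfl⟩ := ofSpan_surj f
    refine ofSpan_eq (QSpan.graph_naturality (s.tensor (QSpan.id Q C.alg.carrier))
      ((QSpan.id Q C.alg.carrier).tensor s)
      (β_ A.alg.carrier C.alg.carrier) (β_ B.alg.carrier C.alg.carrier).hom (β_ _ _) ?_ ?_ ?_)
    · simp
    · simp
    · simp only [QSpan.tensor_mul, MonObj.comp_mul, braiding_hom_fst_assoc, braiding_hom_snd_assoc]
      rw [mul_comm]
  hexagon_forward X Y Z := by
    simp only [← MonoidalCategory.id_tensorHom, ← MonoidalCategory.tensorHom_id, graphIso,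
      associator_hom_eq, ← graph_id, graph_tensor, graph_comp]
    congr 1
    exact (BraidedCategory.hexagon_forward X.alg.carrier Y.alg.carrier Z.alg.carrier).trans
      (by simp)
  hexagon_reverse X Y Z := by
    simp only [← MonoidalCategory.id_tensorHom, ← MonoidalCategory.tensorHom_id, graphIso,
      associator_inv_eq, ← graph_id, graph_tensor, graph_comp]
    congr 1
    exact (BraidedCategory.hexagon_reverse X.alg.carrier Y.alg.carrier Z.alg.carrier).trans
      (by simp)
  symmetry X Y := by
    simp only [graphIso, graph_comp, ← graph_id]
    congr 1
    exact SymmetricCategory.symmetry X.alg.carrier Y.alg.carrier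

end SpanCat

/-! ### Truth values -/

lemma holds_χ {T U X : E} (m : U ⟶ X) [Mono m] (y : T ⟶ X) :
    Holds (y ≫ HasSubobjectClassifier.χ m) ↔ ∃ z, z ≫ m = y := by
  constructor
  · intro h
    exact ⟨(HasSubobjectClassifier.isPullback_χ m).lift y (Subobject.Classifier.χ₀ _ T) h,
      IsPullback.lift_fst _ _ _ _⟩
  · rintro ⟨z, rfl⟩
    rw [Category.assoc, HasSubobjectClassifier.comm m]
    exact comp_trueAt z

lemma holds_ext {X : E} {p q : X ⟶ HasSubobjectClassifier.Ω E}
    (h : ∀ (T : E) (u : T ⟶ X), Holds (u ≫ p) ↔ Holds (u ≫ q)) : p = q := by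
  obtain ⟨U, m, hm, hp⟩ := Subobject.Classifier.surjective_χ
    (HasSubobjectClassifier.exists_classifier (C := E)).some p
  replace hp : p = HasSubobjectClassifier.χ m := hp
  subst hp
  symm
  apply HasSubobjectClassifier.unique
  have key : ∀ {T : E} (y : T ⟶ X), y ≫ q = Subobject.Classifier.χ₀ _ T ≫
      HasSubobjectClassifier.truth E → ∃ z, z ≫ m = y :=
    fun y hy => (holds_χ m y).1 ((h _ y).2 hy)
  have w : m ≫ q = Subobject.Classifier.χ₀ _ U ≫ HasSubobjectClassifier.truth E :=
    (h _ m).1 ((holds_χ m m).2 ⟨𝟙 _, Category.id_comp _⟩)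
  have key' : ∀ s : PullbackCone q (HasSubobjectClassifier.truth E), ∃ z, z ≫ m = s.fst :=
    fun s => key s.fst (s.condition.trans (by congr 1; exact Subsingleton.elim _ _))
  choose z hz using key'
  exact ⟨⟨w⟩, ⟨PullbackCone.IsLimit.mk _ z hz (fun s => Subsingleton.elim _ _)
    (fun s k hk _ => by rw [← cancel_mono m, hz, hk])⟩⟩

instance : Mono (lift (HasSubobjectClassifier.truth E) (HasSubobjectClassifier.truth E)) :=
  mono_of_mono_fac (lift_fst (HasSubobjectClassifier.truth E) (HasSubobjectClassifier.truth E))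

/-- Conjunction of truth values. -/
def conj (E : Type u) [Category.{v} E] [ElementaryTopos E] :
    HasSubobjectClassifier.Ω E ⊗ HasSubobjectClassifier.Ω E ⟶ HasSubobjectClassifier.Ω E :=
  HasSubobjectClassifier.χ (lift (HasSubobjectClassifier.truth E) (HasSubobjectClassifier.truth E))

lemma holds_conj {T : E} (p q : T ⟶ HasSubobjectClassifier.Ω E) :
    Holds (lift p q ≫ conj E) ↔ Holds p ∧ Holds q := by
  rw [conj, holds_χ]
  constructor
  · rintro ⟨z, hz⟩
    have h1 := congrArg (· ≫ fst _ _) hz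
    have h2 := congrArg (· ≫ snd _ _) hz
    simp only [Category.assoc, lift_fst, lift_snd] at h1 h2
    have hz' : z = Subobject.Classifier.χ₀ _ T := Subsingleton.elim _ _
    subst hz'
    exact ⟨h1.symm, h2.symm⟩
  · rintro ⟨h1, h2⟩
    refine ⟨Subobject.Classifier.χ₀ _ T, ?_⟩
    rw [Holds, trueAt] at h1 h2
    rw [CartesianMonoidalCategory.comp_lift, h1, h2]

lemma conj_true_left :
    lift (trueAt (HasSubobjectClassifier.Ω E)) (𝟙 _) ≫ conj E = 𝟙 _ := by
  apply holds_ext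
  intro T u
  rw [← Category.assoc, CartesianMonoidalCategory.comp_lift, holds_conj, comp_trueAt]
  exact ⟨fun h => h.2, fun h => ⟨rfl, h⟩⟩

instance (X : E) : Mono (lift (𝟙 X) (𝟙 X)) := mono_of_mono_fac (lift_fst (𝟙 X) (𝟙 X))

/-- Internal equality. -/
def eqΩ (X : E) : X ⊗ X ⟶ HasSubobjectClassifier.Ω E := HasSubobjectClassifier.χ (lift (𝟙 X) (𝟙 X))

lemma holds_eqΩ {T X : E} (x y : T ⟶ X) : Holds (lift x y ≫ eqΩ X) ↔ x = y := by
  rw [eqΩ, holds_χ]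
  constructor
  · rintro ⟨z, hz⟩
    have h1 := congrArg (· ≫ fst _ _) hz
    have h2 := congrArg (· ≫ snd _ _) hz
    simp only [Category.assoc, lift_fst, lift_snd, Category.comp_id] at h1 h2
    exact h1.symm.trans h2
  · rintro rfl
    exact ⟨x, by simp [CartesianMonoidalCategory.comp_lift]⟩

/-! ### Logical functors -/

/-- A logical functor: it preserves finite products, exponentials and the subobject classifier,
the latter meaning that the canonical morphism `L Ω ⟶ Ω` (the characteristic morphism of
`L true : L 1 ⟶ L Ω`) is an isomorphism. -/
structure LogicalFunctor (E F : Type u) [Category.{v} E] [Category.{v} F] [ElementaryTopos E]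
    [ElementaryTopos F] where
  toFunctor : E ⥤ F
  preservesFiniteProducts : PreservesFiniteProducts toFunctor
  preservesExponentials : MonoidalClosedFunctor toFunctor
  preservesClassifier :
    IsIso (HasSubobjectClassifier.χ (toFunctor.map (HasSubobjectClassifier.truth E)))

namespace LogicalFunctor

attribute [instance] preservesFiniteProducts preservesExponentials preservesClassifier

variable {F : Type u} [Category.{v} F] [ElementaryTopos F] (L : LogicalFunctor E F)

/-- The canonical monoidal structure of a functor that preserves finite products. -/
instance : L.toFunctor.Braided := Functor.Braided.ofChosenFiniteProducts _

/-- The comparison `L Ω ⟶ Ω`. -/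
abbrev truthComparison :
    L.toFunctor.obj (HasSubobjectClassifier.Ω E) ⟶ HasSubobjectClassifier.Ω F :=
  HasSubobjectClassifier.χ (L.toFunctor.map (HasSubobjectClassifier.truth E))

/-- Truth at stage `T` of a generalised element of `L Ω`. -/
def LHolds {T : F} (p : T ⟶ L.toFunctor.obj (HasSubobjectClassifier.Ω E)) : Prop :=
  Holds (p ≫ L.truthComparison)

/-- The canonical isomorphism `L X × L Y ⟶ L (X × Y)`. -/
abbrev prodInv (X Y : E) : L.toFunctor.obj X ⊗ L.toFunctor.obj Y ⟶ L.toFunctor.obj (X ⊗ Y) :=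
  Functor.LaxMonoidal.μ L.toFunctor X Y

lemma lift_map {T : F} {X Y Z : E} (x : T ⟶ L.toFunctor.obj X) (f : X ⟶ Y) (g : X ⟶ Z) :
    lift (x ≫ L.toFunctor.map f) (x ≫ L.toFunctor.map g) ≫ L.prodInv _ _ =
      x ≫ L.toFunctor.map (lift f g) := by
  rw [← CartesianMonoidalCategory.comp_lift, Category.assoc, Functor.Monoidal.lift_μ]

lemma LHolds_map_true {T : F} {X : E} (x : T ⟶ L.toFunctor.obj X) :
    L.LHolds (x ≫ L.toFunctor.map (trueAt X)) := by
  rw [LHolds, truthComparison, holds_χ]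
  exact ⟨x ≫ L.toFunctor.map (Subobject.Classifier.χ₀ _ X), by
    rw [Category.assoc, ← Functor.map_comp]; rfl⟩

lemma LHolds_unique {T : F} {p q : T ⟶ L.toFunctor.obj (HasSubobjectClassifier.Ω E)}
    (hp : L.LHolds p) (hq : L.LHolds q) : p = q := by
  rw [← cancel_mono L.truthComparison]
  exact Eq.trans hp (Eq.symm hq)

lemma LHolds_map {T : F} {X : E} {p : X ⟶ HasSubobjectClassifier.Ω E} (h : Holds p)
    (x : T ⟶ L.toFunctor.obj X) : L.LHolds (x ≫ L.toFunctor.map p) := by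
  rw [show p = trueAt X from h]
  exact L.LHolds_map_true x

/-- Internal implications are preserved. -/
lemma LHolds_imp {X : E} (p q r : X ⟶ HasSubobjectClassifier.Ω E)
    (h : ∀ (T : E) (u : T ⟶ X), Holds (u ≫ p) → Holds (u ≫ q) → Holds (u ≫ r))
    {T : F} (x : T ⟶ L.toFunctor.obj X) (hp : L.LHolds (x ≫ L.toFunctor.map p))
    (hq : L.LHolds (x ≫ L.toFunctor.map q)) : L.LHolds (x ≫ L.toFunctor.map r) := by
  have e : lift (lift p q ≫ conj E) r ≫ conj E = lift p q ≫ conj E := by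
    apply holds_ext
    intro T u
    simp only [← Category.assoc, CartesianMonoidalCategory.comp_lift]
    simp only [holds_conj]
    exact ⟨fun h => h.1, fun h' => ⟨h', h T u h'.1 h'.2⟩⟩
  have key : ∀ (t s : T ⟶ L.toFunctor.obj (HasSubobjectClassifier.Ω E)), L.LHolds t →
      lift t s ≫ L.prodInv _ _ ≫ L.toFunctor.map (conj E) = s := by
    intro t s ht
    have h1 := L.lift_map s (trueAt (HasSubobjectClassifier.Ω E)) (𝟙 _)
    rw [L.LHolds_unique (L.LHolds_map_true s) ht, CategoryTheory.Functor.map_id, Category.comp_id] at h1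
    rw [← Category.assoc, h1, Category.assoc, ← Functor.map_comp, conj_true_left, CategoryTheory.Functor.map_id,
      Category.comp_id]
  have hmap : ∀ (a b : X ⟶ HasSubobjectClassifier.Ω E),
      x ≫ L.toFunctor.map (lift a b ≫ conj E) =
        lift (x ≫ L.toFunctor.map a) (x ≫ L.toFunctor.map b) ≫ L.prodInv _ _ ≫
          L.toFunctor.map (conj E) := by
    intro a b
    rw [← Category.assoc, L.lift_map, Functor.map_comp, Category.assoc]
  have e' := congrArg (fun f => x ≫ L.toFunctor.map f) e
  simp only [hmap] at e'
  rw [key _ _ hp, key _ _ hq] at e'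
  rw [e']
  exact hq

lemma LHolds_eqΩ {T : F} {X : E} (x y : T ⟶ L.toFunctor.obj X)
    (h : L.LHolds (lift x y ≫ L.prodInv _ _ ≫ L.toFunctor.map (eqΩ X))) : x = y := by
  -- Leibniz: apply the predicate `- = x` of `L X`
  let pr : L.toFunctor.obj X ⊗ T ⟶ L.toFunctor.obj (HasSubobjectClassifier.Ω E) :=
    lift (fst _ _) (snd _ _ ≫ x) ≫ eqΩ _ ≫ inv L.truthComparison
  let P : T ⟶ L.toFunctor.obj ((ihom X).obj (HasSubobjectClassifier.Ω E)) :=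
    MonoidalClosed.curry pr ≫
      inv ((expComparison L.toFunctor X).natTrans.app (HasSubobjectClassifier.Ω E))
  have hP : ∀ z : T ⟶ L.toFunctor.obj X,
      (lift z P ≫ L.prodInv _ _) ≫ L.toFunctor.map ((ihom.ev X).app _) =
        lift z x ≫ eqΩ _ ≫ inv L.truthComparison := by
    intro z
    have h1 := expComparison_ev L.toFunctor X (HasSubobjectClassifier.Ω E)
    have h2 : L.prodInv X ((ihom X).obj (HasSubobjectClassifier.Ω E)) =
        inv (CartesianMonoidalCategory.prodComparison L.toFunctor _ _) := by
      rw [prodInv, Functor.Monoidal.μ_of_cartesianMonoidalCategory]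
      exact IsIso.eq_inv_of_hom_inv_id (prodComparisonIso L.toFunctor _ _).hom_inv_id
    rw [h2, Category.assoc, ← h1]
    have h3 : lift z P ≫ L.toFunctor.obj X ◁
        ((expComparison L.toFunctor X).natTrans.app (HasSubobjectClassifier.Ω E)) =
        lift z (𝟙 _) ≫ L.toFunctor.obj X ◁ MonoidalClosed.curry pr := by
      rw [lift_whiskerLeft, lift_whiskerLeft]
      simp [P]
    rw [← Category.assoc, h3, Category.assoc]
    rw [← MonoidalClosed.uncurry_eq, MonoidalClosed.uncurry_curry]
    simp only [pr, ← Category.assoc, CartesianMonoidalCategory.comp_lift]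
    simp
  have h0 : ∀ z : T ⟶ L.toFunctor.obj X,
      L.LHolds ((lift z P ≫ L.prodInv _ _) ≫ L.toFunctor.map ((ihom.ev X).app _)) ↔ z = x := by
    intro z
    rw [hP, LHolds]
    simp only [Category.assoc, IsIso.inv_hom_id, Category.comp_id, holds_eqΩ]
  symm
  rw [← h0]
  let W : E := (X ⊗ X) ⊗ (ihom X).obj (HasSubobjectClassifier.Ω E)
  let w : T ⟶ L.toFunctor.obj W := lift (lift x y ≫ L.prodInv _ _) P ≫ L.prodInv _ _
  have w1 : w ≫ L.toFunctor.map (fst _ _) = lift x y ≫ L.prodInv _ _ := by simp [w]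
  have w2 : w ≫ L.toFunctor.map (snd _ _) = P := by simp [w]
  have hw : ∀ f : X ⊗ X ⟶ X, (lift ((lift x y ≫ L.prodInv _ _) ≫ L.toFunctor.map f) P ≫
      L.prodInv _ _) = w ≫ L.toFunctor.map (f ▷ _) := by
    intro f
    have : f ▷ (ihom X).obj (HasSubobjectClassifier.Ω E) = lift (fst _ _ ≫ f) (snd _ _) := by
      ext <;> simp
    rw [this, ← L.lift_map, Functor.map_comp, ← w1, w2, Category.assoc]
  have ey : (lift x y ≫ L.prodInv _ _) ≫ L.toFunctor.map (snd _ _) = y := by simp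
  have ex : (lift x y ≫ L.prodInv _ _) ≫ L.toFunctor.map (fst _ _) = x := by simp
  have := L.LHolds_imp (X := W) (fst _ _ ≫ eqΩ X)
    (fst X X ▷ _ ≫ (ihom.ev X).app (HasSubobjectClassifier.Ω E))
    (snd X X ▷ _ ≫ (ihom.ev X).app (HasSubobjectClassifier.Ω E)) ?_ w ?_ ?_
  · rwa [Functor.map_comp, ← Category.assoc, ← hw, ey] at this
  · intro U u hu h1
    have e : u ≫ fst _ _ ≫ fst X X = u ≫ fst _ _ ≫ snd X X := by
      rw [← holds_eqΩ]
      convert hu using 1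
      rw [← Category.assoc, ← Category.assoc, ← Category.assoc, ← CartesianMonoidalCategory.comp_lift,
        lift_fst_snd, Category.comp_id]
    convert h1 using 1
    rw [← Category.assoc, ← Category.assoc]
    congr 1
    ext
    · simpa using e.symm
    · simp
  · rw [Functor.map_comp, ← Category.assoc, w1, Category.assoc]
    exact h
  · rw [Functor.map_comp, ← Category.assoc, ← hw, ex, h0]

end LogicalFunctor

namespace LogicalFunctor

variable {F : Type u} [Category.{v} F] [ElementaryTopos F] (L : LogicalFunctor E F)

/-! #### Identity and composition -/

lemma expComparison_id (X Y : E) :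
    (expComparison (𝟭 E) X).natTrans.app Y = 𝟙 _ := by
  apply MonoidalClosed.uncurry_injective
  rw [uncurry_expComparison, MonoidalClosed.uncurry_eq]
  simp

lemma expComparison_comp {G : Type u} [Category.{v} G] [ElementaryTopos G] (L : E ⥤ F) (M : F ⥤ G)
    [PreservesFiniteProducts L] [PreservesFiniteProducts M] (X Y : E) :
    (expComparison (L ⋙ M) X).natTrans.app Y =
      M.map ((expComparison L X).natTrans.app Y) ≫
        (expComparison M (L.obj X)).natTrans.app (L.obj Y) := by
  apply MonoidalClosed.uncurry_injective
  rw [uncurry_expComparison, MonoidalClosed.uncurry_natural_left, uncurry_expComparison]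
  have h := CartesianMonoidalCategory.prodComparison_inv_natural_whiskerLeft_assoc M (A := L.obj X)
    ((expComparison L X).natTrans.app Y) (M.map ((ihom.ev (L.obj X)).app (L.obj Y)))
  rw [← Functor.map_comp, expComparison_ev, Functor.map_comp] at h
  refine Eq.trans ?_ h
  rw [← Category.assoc]
  congr 1
  simp only [CartesianMonoidalCategory.prodComparison_comp, IsIso.inv_comp, Functor.map_inv]
  rfl

lemma χ_map_id :
    HasSubobjectClassifier.χ ((𝟭 E).map (HasSubobjectClassifier.truth E)) = 𝟙 _ := by
  apply holds_ext
  intro T u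
  rw [holds_χ, Category.comp_id]
  constructor
  · rintro ⟨z, hz⟩
    have hz' : z = Subobject.Classifier.χ₀ _ T :=
      Subsingleton.elim (α := T ⟶ HasSubobjectClassifier.Ω₀ E) _ _
    rw [← hz, hz']
    rfl
  · intro h
    exact ⟨Subobject.Classifier.χ₀ _ T, h.symm⟩

/-- The identity logical functor. -/
def id (E : Type u) [Category.{v} E] [ElementaryTopos E] : LogicalFunctor E E where
  toFunctor := 𝟭 E
  preservesFiniteProducts := inferInstance
  preservesExponentials := ⟨fun X => by
    have : ∀ Y, IsIso ((expComparison (𝟭 E) X).natTrans.app Y) := fun Y => by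
      rw [expComparison_id]; infer_instance
    apply NatIso.isIso_of_isIso_app⟩
  preservesClassifier := by
    rw [χ_map_id]; infer_instance

lemma truthComparison_comp {G : Type u} [Category.{v} G] [ElementaryTopos G]
    (M : LogicalFunctor F G) :
    HasSubobjectClassifier.χ
      ((L.toFunctor ⋙ M.toFunctor).map (HasSubobjectClassifier.truth E)) =
      M.toFunctor.map L.truthComparison ≫ M.truthComparison := by
  apply holds_ext
  intro T u
  rw [holds_χ, ← Category.assoc, holds_χ]
  constructor
  · rintro ⟨z, rfl⟩
    refine ⟨z ≫ M.toFunctor.map (Subobject.Classifier.χ₀ _ _), ?_⟩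
    rw [Category.assoc, Category.assoc, Functor.comp_map, ← Functor.map_comp, ← Functor.map_comp,
      HasSubobjectClassifier.comm]
  · rintro ⟨z, hz⟩
    obtain ⟨y, hy⟩ := (holds_χ (L.toFunctor.map (HasSubobjectClassifier.truth E))
      (HasSubobjectClassifier.truth F ≫ inv L.truthComparison)).1 (by
        rw [Category.assoc, IsIso.inv_hom_id, Category.comp_id, Holds, trueAt,
          show Subobject.Classifier.χ₀ _ _ = 𝟙 (HasSubobjectClassifier.Ω₀ F) from
            Subsingleton.elim _ _, Category.id_comp])
    refine ⟨z ≫ M.toFunctor.map y, ?_⟩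
    rw [Functor.comp_map, Category.assoc, ← Functor.map_comp, hy, Functor.map_comp,
      ← Category.assoc, hz, Category.assoc, ← Functor.map_comp, IsIso.hom_inv_id,
      CategoryTheory.Functor.map_id]
    exact Category.comp_id u

/-- The composite of two logical functors. -/
def comp {G : Type u} [Category.{v} G] [ElementaryTopos G] (L : LogicalFunctor E F)
    (M : LogicalFunctor F G) : LogicalFunctor E G where
  toFunctor := L.toFunctor ⋙ M.toFunctor
  preservesFiniteProducts := inferInstance
  preservesExponentials := ⟨fun X => by
    have : ∀ Y, IsIso ((expComparison (L.toFunctor ⋙ M.toFunctor) X).natTrans.app Y) := fun Y => by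
      rw [expComparison_comp]; infer_instance
    apply NatIso.isIso_of_isIso_app⟩
  preservesClassifier := by
    rw [truthComparison_comp]; infer_instance

/-! #### The action on algebras, ordered monoids and spans -/

/-- The operations of `L A`: `(L A)ⁿ ≅ L (Aⁿ) ⟶ L A`. -/
def mapOp {X : E} {n : ℕ} (f : pow X n ⟶ X) : pow (L.toFunctor.obj X) n ⟶ L.toFunctor.obj X :=
  inv (piComparison L.toFunctor fun _ : Fin n => X) ≫ L.toFunctor.map f

lemma tuple_mapOp {T X : E} {n : ℕ} (f : pow X n ⟶ X) (x : Fin n → (T ⟶ X)) :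
    tuple (fun i => L.toFunctor.map (x i)) ≫ L.mapOp f = L.toFunctor.map (tuple x ≫ f) := by
  rw [mapOp, ← Category.assoc, Functor.map_comp]
  congr 1
  rw [IsIso.comp_inv_eq, map_lift_piComparison]

lemma map_termVal {S : Operations.{w}} {X : E} (op : ∀ σ : S.Op, pow X (S.arity σ) ⟶ X)
    {T : E} {n : ℕ} (x : Fin n → (T ⟶ X)) (t : Term S n) :
    L.toFunctor.map (termVal op x t) =
      termVal (fun σ => L.mapOp (op σ)) (fun i => L.toFunctor.map (x i)) t := by
  induction t with
  | var i => rfl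
  | app σ ts ih => rw [termVal, termVal, ← L.tuple_mapOp]; simp only [ih]

/-- The image `L A` of an algebra. -/
def mapAlg (A : Algebra S E) : Algebra S F where
  carrier := L.toFunctor.obj A.carrier
  op σ := L.mapOp (A.op σ)
  sat n p hp := by
    have h := congrArg (fun f => inv (piComparison L.toFunctor fun _ : Fin n => A.carrier) ≫
      L.toFunctor.map f) (A.sat n p hp)
    simpa only [map_termVal, comp_termVal, inv_piComparison_comp_map_π] using h

/-- The image of a commutative monoid object. -/
instance mapMon (M : E) [MonObj M] : MonObj (L.toFunctor.obj M) := L.toFunctor.monObjObj M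

lemma map_mul_le {Q : OrderedCommMonoid E} {T : F} (x x' y y' : T ⟶ L.toFunctor.obj Q.X)
    (h : L.LHolds ((lift x x' ≫ L.prodInv _ _) ≫ L.toFunctor.map Q.le))
    (h' : L.LHolds ((lift y y' ≫ L.prodInv _ _) ≫ L.toFunctor.map Q.le)) :
    L.LHolds ((lift (x * y) (x' * y') ≫ L.prodInv _ _) ≫ L.toFunctor.map Q.le) := by
  let W : E := (Q.X ⊗ Q.X) ⊗ (Q.X ⊗ Q.X)
  let w : T ⟶ L.toFunctor.obj W :=
    lift (lift x x' ≫ L.prodInv _ _) (lift y y' ≫ L.prodInv _ _) ≫ L.prodInv _ _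
  let a : W ⟶ Q.X := fst _ _ ≫ fst _ _
  let a' : W ⟶ Q.X := fst _ _ ≫ snd _ _
  let b : W ⟶ Q.X := snd _ _ ≫ fst _ _
  let b' : W ⟶ Q.X := snd _ _ ≫ snd _ _
  have ha : w ≫ L.toFunctor.map a = x := by simp [w, a]
  have ha' : w ≫ L.toFunctor.map a' = x' := by simp [w, a']
  have hb : w ≫ L.toFunctor.map b = y := by simp [w, b]
  have hb' : w ≫ L.toFunctor.map b' = y' := by simp [w, b']
  have hle : ∀ c d : W ⟶ Q.X, w ≫ L.toFunctor.map (lift c d ≫ Q.le) =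
      (lift (w ≫ L.toFunctor.map c) (w ≫ L.toFunctor.map d) ≫ L.prodInv _ _) ≫
        L.toFunctor.map Q.le := by
    intro c d
    rw [L.lift_map, Functor.map_comp]
    exact (Category.assoc _ _ _).symm
  have hmul : ∀ c d : W ⟶ Q.X, w ≫ L.toFunctor.map (c * d) =
      (w ≫ L.toFunctor.map c) * (w ≫ L.toFunctor.map d) := by
    intro c d
    rw [Functor.map_mul, MonObj.comp_mul]
  have := L.LHolds_imp (lift a a' ≫ Q.le) (lift b b' ≫ Q.le) (lift (a * b) (a' * b') ≫ Q.le)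
    ?_ w ?_ ?_
  · rwa [hle, hmul, hmul, ha, ha', hb, hb'] at this
  · intro U u h1 h2
    rw [← Category.assoc, CartesianMonoidalCategory.comp_lift] at h1 h2 ⊢
    rw [MonObj.comp_mul, MonObj.comp_mul]
    exact Q.mul_le_mul _ _ _ _ h1 h2
  · rw [hle, ha, ha']; exact h
  · rw [hle, hb, hb']; exact h'

lemma map_le_refl {Q : OrderedCommMonoid E} {T : F} (x : T ⟶ L.toFunctor.obj Q.X) :
    L.LHolds ((lift x x ≫ L.prodInv _ _) ≫ L.toFunctor.map Q.le) := by
  have h := L.LHolds_map (Q.le_refl (𝟙 Q.X)) x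
  rwa [Functor.map_comp, ← Category.assoc, ← L.lift_map, CategoryTheory.Functor.map_id,
    Category.comp_id] at h

lemma map_le_trans {Q : OrderedCommMonoid E} {T : F} (x y z : T ⟶ L.toFunctor.obj Q.X)
    (h : L.LHolds ((lift x y ≫ L.prodInv _ _) ≫ L.toFunctor.map Q.le))
    (h' : L.LHolds ((lift y z ≫ L.prodInv _ _) ≫ L.toFunctor.map Q.le)) :
    L.LHolds ((lift x z ≫ L.prodInv _ _) ≫ L.toFunctor.map Q.le) := by
  let W : E := Q.X ⊗ (Q.X ⊗ Q.X)
  let w : T ⟶ L.toFunctor.obj W := lift x (lift y z ≫ L.prodInv _ _) ≫ L.prodInv _ _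
  let a : W ⟶ Q.X := fst _ _
  let b : W ⟶ Q.X := snd _ _ ≫ fst _ _
  let c : W ⟶ Q.X := snd _ _ ≫ snd _ _
  have ha : w ≫ L.toFunctor.map a = x := by simp [w, a]
  have hb : w ≫ L.toFunctor.map b = y := by simp [w, b]
  have hc : w ≫ L.toFunctor.map c = z := by simp [w, c]
  have hle : ∀ c d : W ⟶ Q.X, w ≫ L.toFunctor.map (lift c d ≫ Q.le) =
      (lift (w ≫ L.toFunctor.map c) (w ≫ L.toFunctor.map d) ≫ L.prodInv _ _) ≫
        L.toFunctor.map Q.le := by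
    intro c d
    rw [L.lift_map, Functor.map_comp]
    exact (Category.assoc _ _ _).symm
  have := L.LHolds_imp (lift a b ≫ Q.le) (lift b c ≫ Q.le) (lift a c ≫ Q.le) ?_ w ?_ ?_
  · rwa [hle, ha, hc] at this
  · intro U u h1 h2
    rw [← Category.assoc, CartesianMonoidalCategory.comp_lift] at h1 h2 ⊢
    exact Q.le_trans _ _ _ h1 h2
  · rw [hle, ha, hb]; exact h
  · rw [hle, hb, hc]; exact h'

lemma map_le_antisymm {Q : OrderedCommMonoid E} {T : F} (x y : T ⟶ L.toFunctor.obj Q.X)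
    (h : L.LHolds ((lift x y ≫ L.prodInv _ _) ≫ L.toFunctor.map Q.le))
    (h' : L.LHolds ((lift y x ≫ L.prodInv _ _) ≫ L.toFunctor.map Q.le)) : x = y := by
  let w : T ⟶ L.toFunctor.obj (Q.X ⊗ Q.X) := lift x y ≫ L.prodInv _ _
  have ha : w ≫ L.toFunctor.map (fst _ _) = x := by simp [w]
  have hb : w ≫ L.toFunctor.map (snd _ _) = y := by simp [w]
  have := L.LHolds_imp Q.le (lift (snd _ _) (fst _ _) ≫ Q.le) (eqΩ Q.X) ?_ w h ?_
  · exact L.LHolds_eqΩ x y (by rwa [← Category.assoc])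
  · intro U u h1 h2
    have hu : u = lift (u ≫ fst _ _) (u ≫ snd _ _) := by ext <;> simp
    rw [hu, holds_eqΩ]
    rw [hu] at h1
    rw [← Category.assoc, CartesianMonoidalCategory.comp_lift] at h2
    exact Q.le_antisymm _ _ h1 h2
  · rw [Functor.map_comp, ← Category.assoc, ← L.lift_map, ha, hb]; exact h'

lemma holds_mapLe {Q : OrderedCommMonoid E} {T : F} (x y : T ⟶ L.toFunctor.obj Q.X) :
    Holds (lift x y ≫ L.prodInv Q.X Q.X ≫ L.toFunctor.map Q.le ≫ L.truthComparison) ↔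
      L.LHolds ((lift x y ≫ L.prodInv _ _) ≫ L.toFunctor.map Q.le) := by
  simp only [LHolds, Category.assoc]

/-- The image `L Q` of an internal partially ordered commutative monoid: unit
`1 ≅ L 1 ⟶ L Q`, multiplication `L Q × L Q ≅ L (Q × Q) ⟶ L Q` and order
`L Q × L Q ≅ L (Q × Q) ⟶ L Ω ≅ Ω`. -/
def mapMonoid (Q : OrderedCommMonoid E) : OrderedCommMonoid F where
  X := L.toFunctor.obj Q.X
  mon := L.mapMon Q.X
  comm := ⟨(L.toFunctor.mapCommMon.obj Q.toCommMon).comm.mul_comm⟩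
  le := L.prodInv Q.X Q.X ≫ L.toFunctor.map Q.le ≫ L.truthComparison
  le_refl x := (L.holds_mapLe _ _).2 (L.map_le_refl x)
  le_trans x y z h h' :=
    (L.holds_mapLe _ _).2 (L.map_le_trans x y z ((L.holds_mapLe _ _).1 h) ((L.holds_mapLe _ _).1 h'))
  le_antisymm x y h h' :=
    L.map_le_antisymm x y ((L.holds_mapLe _ _).1 h) ((L.holds_mapLe _ _).1 h')
  mul_le_mul x x' y y' h h' := (L.holds_mapLe _ _).2
    (L.map_mul_le x x' y y' ((L.holds_mapLe _ _).1 h) ((L.holds_mapLe _ _).1 h'))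

/-- The image `(L X, L f, L g, L χ)` of a span. -/
def mapSpan {Q : OrderedCommMonoid E} {A B : E} (s : QSpan Q A B) :
    QSpan (L.mapMonoid Q) (L.toFunctor.obj A) (L.toFunctor.obj B) where
  apex := L.toFunctor.obj s.apex
  left := L.toFunctor.map s.left
  right := L.toFunctor.map s.right
  char := L.toFunctor.map s.char

end LogicalFunctor

lemma OrderedCommMonoid.ext_of {P Q : OrderedCommMonoid E} (h : P.X = Q.X)
    (h1 : P.mon.one ≍ Q.mon.one) (h2 : P.mon.mul ≍ Q.mon.mul) (h3 : P.le ≍ Q.le) : P = Q := by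
  obtain ⟨⟨X₁⟩, le₁, r₁, t₁, a₁, u₁⟩ := P
  rename_i m₁ c₁
  obtain ⟨⟨X₂⟩, le₂, r₂, t₂, a₂, u₂⟩ := Q
  rename_i m₂ c₂
  dsimp only at h
  subst h
  have hm : m₁ = m₂ := by
    cases m₁
    cases m₂
    dsimp only at h1 h2
    cases h1
    cases h2
    rfl
  subst hm
  cases h3
  rfl

namespace LogicalFunctor

variable {F : Type u} [Category.{v} F] [ElementaryTopos F] (L : LogicalFunctor E F)

lemma truthComparison_id : (id E).truthComparison = 𝟙 _ := χ_map_id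

/-- `id Q = Q`. -/
lemma mapMonoid_id (Q : OrderedCommMonoid E) : (id E).mapMonoid Q = Q := by
  have hμ : (id E).prodInv Q.X Q.X = 𝟙 (Q.X ⊗ Q.X) := by
    apply CartesianMonoidalCategory.hom_ext
    · exact (Functor.Monoidal.μ_fst (F := (id E).toFunctor) Q.X Q.X).trans
        (Category.id_comp _).symm
    · exact (Functor.Monoidal.μ_snd (F := (id E).toFunctor) Q.X Q.X).trans
        (Category.id_comp _).symm
  have hε : Functor.LaxMonoidal.ε (id E).toFunctor = 𝟙 (𝟙_ E) := toUnit_unique _ _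
  have e1 : Functor.LaxMonoidal.ε (id E).toFunctor ≫ (id E).toFunctor.map Q.mon.one =
      Q.mon.one := by
    rw [hε]; exact Category.id_comp _
  have e2 : (id E).prodInv Q.X Q.X ≫ (id E).toFunctor.map Q.mon.mul = Q.mon.mul := by
    rw [hμ]; exact Category.id_comp _
  have e3 : (id E).prodInv Q.X Q.X ≫ (id E).toFunctor.map Q.le ≫ (id E).truthComparison =
      Q.le := by
    rw [hμ, truthComparison_id]
    exact (Category.id_comp _).trans (Category.comp_id _)
  exact OrderedCommMonoid.ext_of rfl (heq_of_eq e1) (heq_of_eq e2) (heq_of_eq e3)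

/-- `(M ∘ L) Q = M (L Q)`. -/
lemma mapMonoid_comp {G : Type u} [Category.{v} G] [ElementaryTopos G] (M : LogicalFunctor F G)
    (Q : OrderedCommMonoid E) : (L.comp M).mapMonoid Q = M.mapMonoid (L.mapMonoid Q) := by
  have hμ : (L.comp M).prodInv Q.X Q.X =
      M.prodInv (L.toFunctor.obj Q.X) (L.toFunctor.obj Q.X) ≫
        M.toFunctor.map (L.prodInv Q.X Q.X) :=
    letI : (L.toFunctor ⋙ M.toFunctor).Monoidal :=
      (inferInstance : (L.comp M).toFunctor.Monoidal)
    Functor.Monoidal.μ_comp L.toFunctor M.toFunctor Q.X Q.X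
  have hε : Functor.LaxMonoidal.ε (L.comp M).toFunctor =
      Functor.LaxMonoidal.ε M.toFunctor ≫ M.toFunctor.map (Functor.LaxMonoidal.ε L.toFunctor) :=
    (cancel_mono (Functor.Monoidal.εIso (L.comp M).toFunctor).inv).1 (toUnit_unique _ _)
  have e1 : Functor.LaxMonoidal.ε (L.comp M).toFunctor ≫ (L.comp M).toFunctor.map Q.mon.one =
      Functor.LaxMonoidal.ε M.toFunctor ≫ M.toFunctor.map
        (Functor.LaxMonoidal.ε L.toFunctor ≫ L.toFunctor.map Q.mon.one) := by
    rw [hε, Functor.map_comp]; exact Category.assoc _ _ _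
  have e2 : (L.comp M).prodInv Q.X Q.X ≫ (L.comp M).toFunctor.map Q.mon.mul =
      M.prodInv _ _ ≫ M.toFunctor.map (L.prodInv Q.X Q.X ≫ L.toFunctor.map Q.mon.mul) := by
    rw [hμ, Functor.map_comp]; exact Category.assoc _ _ _
  have e3 : (L.comp M).prodInv Q.X Q.X ≫ (L.comp M).toFunctor.map Q.le ≫
      (L.comp M).truthComparison =
      M.prodInv _ _ ≫ M.toFunctor.map (L.prodInv Q.X Q.X ≫ L.toFunctor.map Q.le ≫
        L.truthComparison) ≫ M.truthComparison := by
    rw [hμ, show (L.comp M).truthComparison = _ from L.truthComparison_comp M, Functor.map_comp,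
      Functor.map_comp]
    simp only [Category.assoc]
    exact Category.assoc _ _ _
  exact OrderedCommMonoid.ext_of rfl (heq_of_eq e1) (heq_of_eq e2) (heq_of_eq e3)

end LogicalFunctor

/-! ### Symmetric monoidal functors -/

/-- A (strong) symmetric monoidal functor between symmetric monoidal categories. -/
structure SymmetricMonoidalFunctor (C : Type*) (D : Type*) [Category* C] [Category* D]
    [MonoidalCategory C] [MonoidalCategory D] [SymmetricCategory C] [SymmetricCategory D] where
  toFunctor : C ⥤ D
  braided : toFunctor.Braided

namespace SymmetricMonoidalFunctor

attribute [instance] braided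

/-- The identity functor. -/
def id (C : Type*) [Category* C] [MonoidalCategory C] [SymmetricCategory C] :
    SymmetricMonoidalFunctor C C where
  toFunctor := 𝟭 C
  braided := inferInstance

/-- Composition, with the usual composite structure morphisms. -/
def comp {C D D' : Type*} [Category* C] [Category* D] [Category* D']
    [MonoidalCategory C] [MonoidalCategory D] [MonoidalCategory D'] [SymmetricCategory C]
    [SymmetricCategory D] [SymmetricCategory D'] (K : SymmetricMonoidalFunctor C D)
    (K' : SymmetricMonoidalFunctor D D') : SymmetricMonoidalFunctor C D' where
  toFunctor := K.toFunctor ⋙ K'.toFunctor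
  braided := inferInstance

end SymmetricMonoidalFunctor

/-- Equal ordered monoids have the same category of spans. -/
def SpanCat.transport {Q Q' : OrderedCommMonoid E} (h : Q = Q') :
    SymmetricMonoidalFunctor (SpanCat S Q) (SpanCat S Q') :=
  h ▸ SymmetricMonoidalFunctor.id (SpanCat S Q)

/-- A functor is given on objects by `A ↦ L A` and on morphisms by
`(X, f, g, χ) ↦ (L X, L f, L g, L χ)`. -/
def IsInduced {F : Type u} [Category.{v} F] [ElementaryTopos F] (L : LogicalFunctor E F)
    {Q : OrderedCommMonoid E} (K : SpanCat S Q ⥤ SpanCat S (L.mapMonoid Q)) : Prop :=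
  ∃ hobj : ∀ A : SpanCat S Q, K.obj A = ⟨L.mapAlg A.alg⟩,
    ∀ (A B : SpanCat S Q) (s : QSpan Q A.alg.carrier B.alg.carrier)
      (hs : IsAlgebraic A.alg B.alg s),
      ∃ hs' : IsAlgebraic (L.mapAlg A.alg) (L.mapAlg B.alg) (L.mapSpan s),
        K.map (SpanCat.ofSpan s hs) =
          eqToHom (hobj A) ≫
            SpanCat.ofSpan (A := ⟨L.mapAlg A.alg⟩) (B := ⟨L.mapAlg B.alg⟩) (L.mapSpan s) hs' ≫
              eqToHom (hobj B).symm

end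

end QSpans

/-! A logical functor is only assumed to preserve finite products, exponentials and the subobject
classifier, but its action on spans also needs pullbacks, for composition, and epimorphisms, for the
existential quantifier in algebraicity. Both are obtained by transferring internal statements from E
to F. By `LHolds_imp`, an implication between predicates on X that is valid at all generalised
elements in E stays valid at all generalised elements of L X in F, including those that do not come
from E; by `LHolds_eqΩ`, equations may occur among these predicates.

Preservation of monomorphisms is the transfer of injectivity. Surjectivity is first expressed
without an existential quantifier: U covers the part χ of X when every predicate that is true along
U is true on χ. This quantifies over Ω^X, and since L preserves exponentials and Ω, every predicate
on L X is named by an element of L(Ω^X); this is `holds_of_cover`. With χ = true it shows that L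
preserves epimorphisms. Applied to the characteristic morphism of L m it shows that L preserves the
subobject m cut out by a predicate, hence pullbacks, since X ×_B Y is the part f x = g y of X × Y.

Algebraicity of a span is a condition at all stages and all tuples, but it suffices to check it at
the generic tuple, the projections of Xⁿ, because covers can be pulled back (`epi_pullback_fst`).
The generic tuple of L X is the image under L of the generic tuple of X, and L preserves the cover
witnessing algebraicity there. So images of algebraic spans are algebraic (`isAlgebraic_mapSpan`),
and preservation of pullbacks makes L* a functor.

The comparison morphisms of L* are the graphs of those of L. Graphs compose and tensor like the
underlying morphisms, so the coherence laws reduce to those of L for the product structures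
(`starCore`, `starBraided`). For the same reason the comparisons of the identity and of a composite
are the expected ones. The equalities id Q = Q and (M ∘ L) Q = M (L Q) are not definitional, so the
functors are compared after transport, by heterogeneous equality of objects, morphisms and
comparison maps. -/

namespace QSpans

noncomputable section

/-! ### Epimorphisms in a topos -/

section Epi

variable {E : Type u} [Category.{v} E] [ElementaryTopos E]

/-- Implication of truth values: `p ∧ q = p`. -/
def impΩ {T : E} (p q : T ⟶ HasSubobjectClassifier.Ω E) : T ⟶ HasSubobjectClassifier.Ω E :=
  lift (lift p q ≫ conj E) p ≫ eqΩ _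

/-- The Kripke–Joyal clause for implication. The equation p ∧ q = p between morphisms to Ω can be
tested at all later stages by `holds_ext`, where it says that p forces q. -/
lemma holds_impΩ {T T' : E} (p q : T ⟶ HasSubobjectClassifier.Ω E) (u : T' ⟶ T) :
    Holds (u ≫ impΩ p q) ↔ ∀ (R : E) (r : R ⟶ T'), Holds (r ≫ u ≫ p) → Holds (r ≫ u ≫ q) := by
  have key : Holds (u ≫ impΩ p q) ↔ u ≫ lift p q ≫ conj E = u ≫ p := by
    rw [impΩ, ← Category.assoc, CartesianMonoidalCategory.comp_lift, holds_eqΩ]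
  rw [key]
  constructor
  · intro h R r hp
    have := congrArg (r ≫ ·) h
    rw [← this, ← Category.assoc u, ← Category.assoc r, CartesianMonoidalCategory.comp_lift,
      CartesianMonoidalCategory.comp_lift, holds_conj] at hp
    exact hp.2
  · intro h
    apply holds_ext
    intro R r
    rw [← Category.assoc u, ← Category.assoc r, CartesianMonoidalCategory.comp_lift,
      CartesianMonoidalCategory.comp_lift, holds_conj]
    exact ⟨fun h' => h'.1, fun h' => ⟨h', h R r h'⟩⟩

/-- Universal quantification over `X`. -/
def forallΩ {T X : E} (p : X ⊗ T ⟶ HasSubobjectClassifier.Ω E) : T ⟶ HasSubobjectClassifier.Ω E :=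
  lift (MonoidalClosed.curry p) (MonoidalClosed.curry (trueAt (X ⊗ T))) ≫ eqΩ _

/-- The Kripke–Joyal clause for the universal quantifier. Uncurrying the equality with the name of
`true` says that p is true on X × T', that is, at its generic element and therefore at all elements.
-/
lemma holds_forallΩ {T X T' : E} (p : X ⊗ T ⟶ HasSubobjectClassifier.Ω E) (u : T' ⟶ T) :
    Holds (u ≫ forallΩ p) ↔ ∀ (R : E) (r : R ⟶ T') (x : R ⟶ X), Holds (lift x (r ≫ u) ≫ p) := by
  have key : Holds (u ≫ forallΩ p) ↔ X ◁ u ≫ p = trueAt _ := by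
    rw [forallΩ, ← Category.assoc, CartesianMonoidalCategory.comp_lift, holds_eqΩ,
      ← MonoidalClosed.curry_natural_left, ← MonoidalClosed.curry_natural_left, comp_trueAt]
    exact ⟨fun h => MonoidalClosed.curry_injective h, fun h => congrArg _ h⟩
  rw [key]
  constructor
  · intro h R r x
    have : Holds (lift x r ≫ X ◁ u ≫ p) := Holds.comp h _
    rwa [← Category.assoc, lift_whiskerLeft] at this
  · intro h
    have := h _ (snd X T') (fst X T')
    have e : lift (fst X T') (snd X T' ≫ u) = X ◁ u := by ext <;> simp
    rwa [e] at this

/-- A morphism is epic as soon as every truth value it satisfies is true. -/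
lemma epi_of_holds {U X : E} (e : U ⟶ X)
    (h : ∀ p : X ⟶ HasSubobjectClassifier.Ω E, Holds (e ≫ p) → Holds p) : Epi e := by
  constructor
  intro Z f g hfg
  -- The equality of f and g is itself a truth value on X, and it holds along e.
  rw [← holds_eqΩ]
  apply h
  rw [← Category.assoc, CartesianMonoidalCategory.comp_lift, holds_eqΩ, hfg]

/-- Truth is local for epimorphisms: p and `true` agree after composition with e, so e can be
cancelled. -/
lemma Holds.of_epi {U X : E} (e : U ⟶ X) [Epi e] {p : X ⟶ HasSubobjectClassifier.Ω E}
    (h : Holds (e ≫ p)) : Holds p := by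
  rw [Holds, ← cancel_epi e, comp_trueAt]
  exact h

/-- Epimorphisms in a topos are stable under pullback. -/
lemma epi_pullback_fst {X Y B : E} (f : X ⟶ B) (g : Y ⟶ B) [Epi g] : Epi (pullback.fst f g) := by
  apply epi_of_holds
  intro p hp
  -- the predicate `∀ x, f x = b → p x` of `b`
  let q : B ⟶ HasSubobjectClassifier.Ω E :=
    forallΩ (impΩ (lift (fst X B ≫ f) (snd X B) ≫ eqΩ B) (fst X B ≫ p))
  -- Only stages g y have to be examined, as g is epic. There f x = g y puts (x, y) in the pullback,
  -- where p x is known.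
  have hq : Holds q := by
    apply Holds.of_epi g
    rw [holds_forallΩ]
    intro R r x
    rw [holds_impΩ]
    intro R' r' h
    have h' : (r' ≫ x) ≫ f = (r' ≫ r) ≫ g := by
      rw [← holds_eqΩ]
      convert h using 1
      simp [← Category.assoc, CartesianMonoidalCategory.comp_lift]
    have := Holds.comp hp (pullback.lift _ _ h')
    rw [pullback.lift_fst_assoc] at this
    simpa using this
  -- Instantiate at b = f x for the generic element x of X; the premise f x = b is then reflexivity.
  have := (holds_forallΩ _ f).1 (Holds.comp hq f) X (𝟙 X) (𝟙 X)
  rw [holds_impΩ] at this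
  have h1 := this X (𝟙 X) (by
    simp only [← Category.assoc, CartesianMonoidalCategory.comp_lift]
    rw [holds_eqΩ]; simp)
  simpa using h1

end Epi

/-! ### Preservation properties of logical functors -/

namespace LogicalFunctor

variable {E : Type u} [Category.{v} E] [ElementaryTopos E]
variable {F : Type u} [Category.{v} F] [ElementaryTopos F] (L : LogicalFunctor E F)

/-- The image under L of internal equality on X is internal equality on L X: one direction is the
Leibniz argument of `LHolds_eqΩ`, the other is reflexivity. -/
lemma LHolds_eqΩ_iff {T : F} {X : E} (x y : T ⟶ L.toFunctor.obj X) :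
    L.LHolds (lift x y ≫ L.prodInv _ _ ≫ L.toFunctor.map (eqΩ X)) ↔ x = y := by
  refine ⟨L.LHolds_eqΩ x y, ?_⟩
  rintro rfl
  have h := L.lift_map x (𝟙 X) (𝟙 X)
  rw [CategoryTheory.Functor.map_id, Category.comp_id] at h
  rw [← Category.assoc, h, Category.assoc, ← Functor.map_comp]
  exact L.LHolds_map ((holds_eqΩ _ _).2 rfl) x

/-- The form in which equations enter `LHolds_imp`, either as premises or as the conclusion. -/
lemma LHolds_map_eqΩ_iff {T : F} {X Y : E} (f g : X ⟶ Y) (x : T ⟶ L.toFunctor.obj X) :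
    L.LHolds (x ≫ L.toFunctor.map (lift f g ≫ eqΩ Y)) ↔
      x ≫ L.toFunctor.map f = x ≫ L.toFunctor.map g := by
  rw [← L.LHolds_eqΩ_iff, ← Category.assoc (lift _ _), L.lift_map, Functor.map_comp,
    Category.assoc]

/-- Logical functors preserve monomorphisms. -/
instance map_mono {X Y : E} (m : X ⟶ Y) [Mono m] : Mono (L.toFunctor.map m) := by
  constructor
  intro T x y h
  let z : T ⟶ L.toFunctor.obj (X ⊗ X) := lift x y ≫ L.prodInv _ _
  have hx : z ≫ L.toFunctor.map (fst _ _) = x := by simp [z]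
  have hy : z ≫ L.toFunctor.map (snd _ _) = y := by simp [z]
  have hz : L.LHolds (z ≫ L.toFunctor.map (lift (fst X X ≫ m) (snd X X ≫ m) ≫ eqΩ Y)) := by
    rw [LHolds_map_eqΩ_iff, Functor.map_comp, Functor.map_comp, ← Category.assoc,
      ← Category.assoc, hx, hy, h]
  -- Injectivity of m, an implication between two equations on X × X, is transferred. `LHolds_imp`
  -- has two premises, so the single one is supplied twice.
  have := L.LHolds_imp _ _ (lift (fst X X) (snd X X) ≫ eqΩ X) ?_ z hz hz
  · rwa [LHolds_map_eqΩ_iff, hx, hy] at this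
  · intro U u hu _
    rw [← Category.assoc, CartesianMonoidalCategory.comp_lift, holds_eqΩ] at hu ⊢
    rw [← cancel_mono m]
    simpa using hu

/-! ### Generalised elements of the image of an exponential -/

/-- Evaluation of generalised elements of `L (Zˣ)`. -/
abbrev evalAt {T : F} {X Z : E} (z : T ⟶ L.toFunctor.obj X)
    (P : T ⟶ L.toFunctor.obj ((ihom X).obj Z)) : T ⟶ L.toFunctor.obj Z :=
  (lift z P ≫ L.prodInv _ _) ≫ L.toFunctor.map ((ihom.ev X).app Z)

/-- The exponential comparison is compatible with evaluation. This reduces evaluation in L(Z^X) to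
evaluation in (L Z)^(L X), where morphisms can be curried in F. -/
lemma evalAt_eq {T : F} {X Z : E} (z : T ⟶ L.toFunctor.obj X)
    (P : T ⟶ L.toFunctor.obj ((ihom X).obj Z)) :
    L.evalAt z P = lift z (P ≫ (expComparison L.toFunctor X).natTrans.app Z) ≫
      (ihom.ev (L.toFunctor.obj X)).app (L.toFunctor.obj Z) := by
  have h1 := expComparison_ev L.toFunctor X Z
  have h2 : L.prodInv X ((ihom X).obj Z) =
      inv (CartesianMonoidalCategory.prodComparison L.toFunctor _ _) := by
    rw [prodInv, Functor.Monoidal.μ_of_cartesianMonoidalCategory]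
    exact IsIso.eq_inv_of_hom_inv_id (prodComparisonIso L.toFunctor _ _).hom_inv_id
  rw [evalAt, h2, Category.assoc, ← h1, ← Category.assoc, lift_whiskerLeft]

/-- Extensionality for generalised elements of `L (Zˣ)`. -/
lemma exp_ext {T : F} {X Z : E} (P P' : T ⟶ L.toFunctor.obj ((ihom X).obj Z))
    (h : ∀ (R : F) (r : R ⟶ T) (z : R ⟶ L.toFunctor.obj X),
      L.evalAt z (r ≫ P) = L.evalAt z (r ≫ P')) : P = P' := by
  rw [← cancel_mono ((expComparison L.toFunctor X).natTrans.app Z)]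
  apply MonoidalClosed.uncurry_injective
  -- At the stage L X × T, with the first projection as argument, evaluation is uncurrying.
  have h' := h _ (snd (L.toFunctor.obj X) T) (fst _ _)
  rw [evalAt_eq, evalAt_eq] at h'
  have e : ∀ a : T ⟶ (ihom (L.toFunctor.obj X)).obj (L.toFunctor.obj Z),
      L.toFunctor.obj X ◁ a = lift (fst _ _) (snd _ _ ≫ a) := fun a => by ext <;> simp
  rw [MonoidalClosed.uncurry_eq, MonoidalClosed.uncurry_eq]
  simp only [Category.assoc] at h'
  exact (congrArg (· ≫ _) (e _)).trans (h'.trans (congrArg (· ≫ _) (e _)).symm)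

/-- The element of `L (Zˣ)` at stage `T` given by a morphism `L X ⟶ L Z`. -/
def expName (T : F) {X Z : E} (s : L.toFunctor.obj X ⟶ L.toFunctor.obj Z) :
    T ⟶ L.toFunctor.obj ((ihom X).obj Z) :=
  MonoidalClosed.curry (fst _ T ≫ s) ≫ inv ((expComparison L.toFunctor X).natTrans.app Z)

lemma comp_expName {T R : F} (r : R ⟶ T) {X Z : E} (s : L.toFunctor.obj X ⟶ L.toFunctor.obj Z) :
    r ≫ L.expName T s = L.expName R s := by
  rw [expName, expName, ← Category.assoc, ← MonoidalClosed.curry_natural_left,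
    whiskerLeft_fst_assoc]

lemma evalAt_expName {T : F} {X Z : E} (z : T ⟶ L.toFunctor.obj X)
    (s : L.toFunctor.obj X ⟶ L.toFunctor.obj Z) : L.evalAt z (L.expName T s) = z ≫ s := by
  rw [evalAt_eq, expName, Category.assoc, IsIso.inv_hom_id, Category.comp_id]
  have : lift z (MonoidalClosed.curry (fst (L.toFunctor.obj X) T ≫ s)) =
      lift z (𝟙 T) ≫ L.toFunctor.obj X ◁ MonoidalClosed.curry (fst (L.toFunctor.obj X) T ≫ s) := by
    rw [lift_whiskerLeft, Category.id_comp]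
  rw [this, Category.assoc, ← MonoidalClosed.uncurry_eq, MonoidalClosed.uncurry_curry,
    lift_fst_assoc]

/-- Naturality of the product comparison moves the evaluation inside L, so that composites with
restriction maps and constant maps in E can be computed before L is applied. -/
lemma evalAt_map {T : F} {X Z W : E} (z : T ⟶ L.toFunctor.obj X) (w : T ⟶ L.toFunctor.obj W)
    (f : W ⟶ (ihom X).obj Z) :
    L.evalAt z (w ≫ L.toFunctor.map f) =
      (lift z w ≫ L.prodInv _ _) ≫ L.toFunctor.map (MonoidalClosed.uncurry f) := by
  rw [MonoidalClosed.uncurry_eq, Functor.map_comp, evalAt, ← Category.assoc, Category.assoc _ _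
    (L.toFunctor.map (X ◁ f)), ← Functor.LaxMonoidal.μ_natural_right, ← Category.assoc,
    lift_whiskerLeft]

/-! ### Covers, subobjects and pullbacks -/

/-- If internally `U ⟶ X` covers the part of `X` described by `χ`, then so does `L U ⟶ L X`
for the part of `L X` described by `L χ`. -/
lemma holds_of_cover {U X : E} (m : U ⟶ X) (χ : X ⟶ HasSubobjectClassifier.Ω E)
    (h : ∀ (T : E) (s : X ⊗ T ⟶ HasSubobjectClassifier.Ω E), Holds (m ▷ T ≫ s) →
      ∀ (x : T ⟶ X), Holds (x ≫ χ) → Holds (lift x (𝟙 T) ≫ s))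
    (s : L.toFunctor.obj X ⟶ HasSubobjectClassifier.Ω F) (hs : Holds (L.toFunctor.map m ≫ s))
    {T : F} (x : T ⟶ L.toFunctor.obj X) (hx : L.LHolds (x ≫ L.toFunctor.map χ)) :
    Holds (x ≫ s) := by
  let Ω := HasSubobjectClassifier.Ω E
  -- The name of s. Inverting the truth comparison turns s into a morphism to L Ω, which
  -- preservation of exponentials makes an element of L(Ω^X).
  let P : T ⟶ L.toFunctor.obj ((ihom X).obj Ω) := L.expName T (s ≫ inv L.truthComparison)
  let res : (ihom X).obj Ω ⟶ (ihom U).obj Ω := (MonoidalClosed.pre m).app Ω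
  let top : (ihom X).obj Ω ⟶ (ihom U).obj Ω := MonoidalClosed.curry (trueAt _)
  have hres : MonoidalClosed.uncurry res = m ▷ _ ≫ (ihom.ev X).app Ω :=
    MonoidalClosed.uncurry_pre m Ω
  -- The assumption that s is true along L m, as an equation in L(Ω^U): the restriction of P along m
  -- is the constant predicate `true`. It is checked pointwise; two elements of L Ω that both hold
  -- coincide.
  have hP : P ≫ L.toFunctor.map res = P ≫ L.toFunctor.map top := by
    apply L.exp_ext
    intro R r z
    rw [← Category.assoc, ← Category.assoc, evalAt_map, evalAt_map, hres,
      MonoidalClosed.uncurry_curry]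
    refine L.LHolds_unique ?_ (L.LHolds_map_true _)
    rw [Functor.map_comp, ← Category.assoc, Category.assoc _ _ (L.toFunctor.map (m ▷ _)),
      ← Functor.LaxMonoidal.μ_natural_left, ← Category.assoc, lift_whiskerRight]
    change L.LHolds (L.evalAt (z ≫ L.toFunctor.map m) (r ≫ P))
    rw [comp_expName, evalAt_expName, LHolds]
    simp only [Category.assoc, IsIso.inv_hom_id, Category.comp_id]
    exact Holds.comp hs z
  let w : T ⟶ L.toFunctor.obj (X ⊗ (ihom X).obj Ω) := lift x P ≫ L.prodInv _ _
  have w1 : w ≫ L.toFunctor.map (fst _ _) = x := by simp [w]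
  have w2 : w ≫ L.toFunctor.map (snd _ _) = P := by simp [w]
  -- The transferred implication, on pairs (x, P) in X × Ω^X: if P is true along m and χ x holds,
  -- then P x holds.
  have := L.LHolds_imp (lift (snd X _ ≫ res) (snd X _ ≫ top) ≫ eqΩ _) (fst X _ ≫ χ)
    ((ihom.ev X).app Ω) ?_ w ?_ ?_
  · change L.LHolds (L.evalAt x P) at this
    rw [evalAt_expName, LHolds] at this
    simpa using this
  · intro R u h1 h2
    rw [← Category.assoc, CartesianMonoidalCategory.comp_lift, holds_eqΩ] at h1
    -- Splits u = (x, P) so that evaluation at u becomes a predicate on X × R, obtained by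
    -- uncurrying P, taken at x. This is the shape required by h.
    have e : u = lift (u ≫ fst _ _) (𝟙 R) ≫ X ◁ (u ≫ snd _ _) := by
      rw [lift_whiskerLeft]; ext <;> simp
    rw [e, Category.assoc]
    apply h
    · rw [← Category.assoc, ← whisker_exchange, Category.assoc, ← hres,
        ← MonoidalClosed.uncurry_natural_left, Category.assoc, h1]
      simp only [top, ← MonoidalClosed.curry_natural_left, MonoidalClosed.uncurry_curry,
        comp_trueAt]
      rfl
    · rwa [Category.assoc]
  · rw [LHolds_map_eqΩ_iff, Functor.map_comp, Functor.map_comp, ← Category.assoc,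
      ← Category.assoc, w2, hP]
  · rwa [Functor.map_comp, ← Category.assoc, w1]

/-- Logical functors preserve epimorphisms. -/
instance map_epi {U X : E} (e : U ⟶ X) [Epi e] : Epi (L.toFunctor.map e) := by
  apply epi_of_holds
  intro s hs
  rw [← Category.id_comp s]
  refine L.holds_of_cover e (trueAt X) ?_ s hs _ (L.LHolds_map_true _)
  intro T s hs x _
  -- Multiplication by T preserves epimorphisms because it is a left adjoint; the symmetry moves T
  -- to the other side.
  have : Epi (e ▷ T) := by
    have e' : e ▷ T = (β_ _ _).hom ≫ T ◁ e ≫ (β_ _ _).hom := by simp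
    have : Epi (T ◁ e) := inferInstanceAs (Epi ((tensorLeft T).map e))
    rw [e']; infer_instance
  exact Holds.comp (Holds.of_epi _ hs) _

/-- Logical functors preserve subobjects given by predicates. -/
lemma exists_lift {U X : E} (m : U ⟶ X) [Mono m] (χ : X ⟶ HasSubobjectClassifier.Ω E)
    (hχ : ∀ (T : E) (x : T ⟶ X), Holds (x ≫ χ) → ∃ z, z ≫ m = x)
    {T : F} (x : T ⟶ L.toFunctor.obj X) (hx : L.LHolds (x ≫ L.toFunctor.map χ)) :
    ∃ z, z ≫ L.toFunctor.map m = x := by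
  -- The predicate to be propagated is the characteristic morphism of the monomorphism L m: it is
  -- true along L m, and its truth at x gives the factorisation.
  rw [← holds_χ]
  refine L.holds_of_cover m χ ?_ _ ((holds_χ _ _).2 ⟨𝟙 _, Category.id_comp _⟩) x hx
  intro T s hs x hx
  obtain ⟨z, rfl⟩ := hχ T x hx
  have := Holds.comp hs (lift z (𝟙 T))
  rwa [← Category.assoc, lift_whiskerRight] at this

/-- Logical functors preserve pullbacks. -/
lemma isPullback_map {X Y B : E} (f : X ⟶ B) (g : Y ⟶ B) :
    IsPullback (L.toFunctor.map (pullback.fst f g)) (L.toFunctor.map (pullback.snd f g))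
      (L.toFunctor.map f) (L.toFunctor.map g) := by
  let m : pullback f g ⟶ X ⊗ Y := lift (pullback.fst f g) (pullback.snd f g)
  have m1 : m ≫ fst _ _ = pullback.fst f g := lift_fst _ _
  have m2 : m ≫ snd _ _ = pullback.snd f g := lift_snd _ _
  have hm : Mono m := ⟨fun a b h => by
    apply pullback.hom_ext
    · rw [← m1, ← Category.assoc, h, Category.assoc]
    · rw [← m2, ← Category.assoc, h, Category.assoc]⟩
  have key : ∀ c : PullbackCone (L.toFunctor.map f) (L.toFunctor.map g),
      ∃ z, z ≫ L.toFunctor.map m = lift c.fst c.snd ≫ L.prodInv _ _ := by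
    intro c
    -- The pullback is the part of X × Y described by f x = g y. Commutativity of a cone over L f
    -- and L g says that its pair of legs satisfies the image of this predicate.
    refine L.exists_lift m (lift (fst X Y ≫ f) (snd X Y ≫ g) ≫ eqΩ B) ?_ _ ?_
    · intro T x hx
      rw [← Category.assoc, CartesianMonoidalCategory.comp_lift, holds_eqΩ] at hx
      simp only [← Category.assoc] at hx
      exact ⟨pullback.lift _ _ hx, by
        ext <;> simp [m, pullback.lift_fst, pullback.lift_snd]⟩
    · rw [LHolds_map_eqΩ_iff]
      simpa using c.condition
  choose z hz using key
  have z1 : ∀ c, z c ≫ L.toFunctor.map (pullback.fst f g) = c.fst := fun c => by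
    rw [← m1, Functor.map_comp, ← Category.assoc, hz]; simp
  have z2 : ∀ c, z c ≫ L.toFunctor.map (pullback.snd f g) = c.snd := fun c => by
    rw [← m2, Functor.map_comp, ← Category.assoc, hz]; simp
  refine ⟨⟨by rw [← Functor.map_comp, ← Functor.map_comp, pullback.condition]⟩,
    ⟨PullbackCone.IsLimit.mk _ z z1 z2 ?_⟩⟩
  intro c k h1 h2
  -- Uniqueness: L m is monic, and inserting the identity δ ≫ μ allows μ to be removed, leaving an
  -- equality of components in the product L X × L Y.
  rw [← cancel_mono (L.toFunctor.map m), hz, ← Category.comp_id (k ≫ _), Category.assoc,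
    ← Functor.Monoidal.δ_μ L.toFunctor, ← Category.assoc, ← Category.assoc]
  congr 1
  ext
  · simp [← Functor.map_comp, m1, h1]
  · simp [← Functor.map_comp, m2, h2]

end LogicalFunctor
end

end QSpans

/-! ### Images of algebraic spans -/

namespace QSpans

noncomputable section

variable {E : Type u} [Category.{v} E] [ElementaryTopos E]
variable {F : Type u} [Category.{v} F] [ElementaryTopos F]
variable {S : AlgSignature.{w}} {Q : OrderedCommMonoid E}

/-- It suffices to check the algebraicity of a span at the universal stages. -/
lemma IsAlgebraic.of_universal {A B : Algebra S E} {s : QSpan Q A.carrier B.carrier}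
    (h : ∀ σ : S.Op, ∃ (P : E) (p : Fin (S.arity σ) → (P ⟶ s.apex))
      (_ : ∀ (T : E) (x : Fin (S.arity σ) → (T ⟶ s.apex)), ∃ w : T ⟶ P, ∀ i, w ≫ p i = x i)
      (T' : E) (e : T' ⟶ P) (_ : Epi e) (y : T' ⟶ s.apex),
      y ≫ s.left = e ≫ tuple (fun i => p i ≫ s.left) ≫ A.op σ ∧
      y ≫ s.right = e ≫ tuple (fun i => p i ≫ s.right) ≫ B.op σ ∧
      Q.Le (e ≫ ∏ i, p i ≫ s.char) (y ≫ s.char)) : IsAlgebraic A B s := by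
  intro σ T x
  obtain ⟨P, p, hp, T', e, he, y, h1, h2, h3⟩ := h σ
  obtain ⟨w, hw⟩ := hp T x
  have c := pullback.condition (f := w) (g := e)
  -- The given tuple is the pullback along w of the universal one, so the cover e and its witness y
  -- are pulled back along w as well.
  refine ⟨pullback w e, pullback.fst w e, epi_pullback_fst w e, pullback.snd w e ≫ y, ?_, ?_, ?_⟩
  · rw [Category.assoc, h1, ← Category.assoc, ← c, Category.assoc, comp_tuple_assoc]
    simp only [← Category.assoc, hw]
  · rw [Category.assoc, h2, ← Category.assoc, ← c, Category.assoc, comp_tuple_assoc]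
    simp only [← Category.assoc, hw]
  · have := h3.comp (pullback.snd w e)
    rw [← Category.assoc, ← c, Category.assoc, comp_prod] at this
    simpa only [← Category.assoc, hw] using this

namespace LogicalFunctor

variable (L : LogicalFunctor E F)

lemma map_Le {T : E} {x y : T ⟶ Q.X} (h : Q.Le x y) :
    (L.mapMonoid Q).Le (L.toFunctor.map x) (L.toFunctor.map y) := by
  refine (L.holds_mapLe (Q := Q) _ _).2 ?_
  rw [Functor.Monoidal.lift_μ, ← Functor.map_comp, ← Category.id_comp (L.toFunctor.map _)]
  exact L.LHolds_map h _

/-- The image of a generalised element of `Q`, as a generalised element of `L Q`. -/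
def mapElt {T : E} (x : T ⟶ Q.X) : L.toFunctor.obj T ⟶ (L.mapMonoid Q).X := L.toFunctor.map x

lemma mapElt_comp {T T' : E} (u : T' ⟶ T) (x : T ⟶ Q.X) :
    L.mapElt (u ≫ x) = L.toFunctor.map u ≫ L.mapElt x :=
  Functor.map_comp _ _ _

lemma mapElt_mul {T : E} (x y : T ⟶ Q.X) : L.mapElt (x * y) = L.mapElt x * L.mapElt y :=
  Functor.map_mul L.toFunctor x y

lemma map_one (T : E) :
    L.toFunctor.map (1 : T ⟶ Q.X) = (1 : L.toFunctor.obj T ⟶ (L.mapMonoid Q).X) :=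
  Functor.map_one L.toFunctor

/-- L induces a monoid homomorphism from the elements of Q at stage T to the elements of L Q at
stage L T. -/
lemma map_prod {T : E} {n : ℕ} (x : Fin n → (T ⟶ Q.X)) :
    L.toFunctor.map (∏ i, x i) =
      ∏ i, (L.toFunctor.map (x i) : L.toFunctor.obj T ⟶ (L.mapMonoid Q).X) :=
  _root_.map_prod (⟨⟨fun f : T ⟶ Q.X => (L.toFunctor.map f :
    L.toFunctor.obj T ⟶ (L.mapMonoid Q).X), L.map_one T⟩, L.mapElt_mul⟩ :
    (T ⟶ Q.X) →* (L.toFunctor.obj T ⟶ (L.mapMonoid Q).X)) x Finset.univ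

/-- Since L preserves finite products, the images of the projections of Xⁿ form a generic n-tuple of
L X. -/
lemma exists_tuple_map {T : F} {X : E} {n : ℕ} (x : Fin n → (T ⟶ L.toFunctor.obj X)) :
    ∃ w : T ⟶ L.toFunctor.obj (pow X n), ∀ i, w ≫ L.toFunctor.map (Pi.π _ i) = x i := by
  refine ⟨tuple x ≫ inv (piComparison L.toFunctor fun _ : Fin n => X), fun i => ?_⟩
  rw [Category.assoc, inv_piComparison_comp_map_π]
  exact Pi.lift_π _ _

/-- The image of an algebraic span is algebraic. -/
lemma isAlgebraic_mapSpan {A B : Algebra S E} {s : QSpan Q A.carrier B.carrier}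
    (hs : IsAlgebraic A B s) : IsAlgebraic (L.mapAlg A) (L.mapAlg B) (L.mapSpan s) := by
  apply IsAlgebraic.of_universal
  intro σ
  -- Algebraicity in E is used only at the generic tuple. The images of the resulting cover and
  -- witness serve in F, because L preserves epimorphisms.
  obtain ⟨T', e, he, y, h1, h2, h3⟩ := hs σ (pow s.apex (S.arity σ)) (fun i => Pi.π _ i)
  refine ⟨L.toFunctor.obj (pow s.apex (S.arity σ)), fun i => L.toFunctor.map (Pi.π _ i), ?_,
    L.toFunctor.obj T', L.toFunctor.map e, inferInstance, L.toFunctor.map y, ?_, ?_, ?_⟩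
  · exact fun T x => L.exists_tuple_map x
  · have := congrArg L.toFunctor.map h1
    simp only [Functor.map_comp] at this
    refine this.trans (congrArg _ ?_)
    rw [← Functor.map_comp, ← tuple_mapOp]
    simp only [Functor.map_comp]
    rfl
  · have := congrArg L.toFunctor.map h2
    simp only [Functor.map_comp] at this
    refine this.trans (congrArg _ ?_)
    rw [← Functor.map_comp, ← tuple_mapOp]
    simp only [Functor.map_comp]
    rfl
  · have := L.map_Le h3
    simp only [Functor.map_comp, map_prod] at this
    exact this

/-! ### The functor L* and its values on graphs -/

lemma mapSpan_congr {A B : E} {s t : QSpan Q A B} (h : QSpan.IsIsomorphic s t) :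
    QSpan.IsIsomorphic (L.mapSpan s) (L.mapSpan t) := by
  obtain ⟨e, h1, h2, h3⟩ := h
  refine ⟨L.toFunctor.mapIso e, ?_, ?_, ?_⟩
  · exact (Functor.map_comp _ _ _).symm.trans (congrArg _ h1)
  · exact (Functor.map_comp _ _ _).symm.trans (congrArg _ h2)
  · exact (Functor.map_comp _ _ _).symm.trans (congrArg _ h3)

lemma mapSpan_graph {A B : E} (f : A ⟶ B) :
    L.mapSpan (QSpan.graph Q f) = QSpan.graph (L.mapMonoid Q) (L.toFunctor.map f) := by
  have h : L.toFunctor.map (toUnit A ≫ MonObj.one (X := Q.X)) = _ := L.map_one (Q := Q) A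
  dsimp only [mapSpan, QSpan.graph]
  rw [CategoryTheory.Functor.map_id, h]
  rfl

/-- The isomorphism of apexes comes from preservation of pullbacks. It respects the characteristic
morphisms because these are products of elements of Q, and L preserves such products. -/
lemma mapSpan_comp {A B C : E} (s : QSpan Q A B) (t : QSpan Q B C) :
    QSpan.IsIsomorphic (L.mapSpan (s.comp t)) ((L.mapSpan s).comp (L.mapSpan t)) := by
  obtain ⟨X, f, g, χ⟩ := s
  obtain ⟨Y, m, n, ξ⟩ := t
  have hp := L.isPullback_map g m
  refine ⟨hp.isoPullback, ?_, ?_, ?_⟩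
  · dsimp only [mapSpan, QSpan.comp]
    rw [hp.isoPullback_hom_fst_assoc, Functor.map_comp]
  · dsimp only [mapSpan, QSpan.comp]
    rw [hp.isoPullback_hom_snd_assoc, Functor.map_comp]
  · have k := QSpan.lift_tensor_mul (Q := L.mapMonoid Q)
      (pullback.fst (L.toFunctor.map g) (L.toFunctor.map m)) (pullback.snd _ _)
      (L.mapElt χ) (L.mapElt ξ)
    have k' := congrArg L.mapElt
      (QSpan.lift_tensor_mul (Q := Q) (pullback.fst g m) (pullback.snd g m) χ ξ)
    refine (congrArg (hp.isoPullback.hom ≫ ·) k).trans (Eq.trans ?_ k'.symm)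
    rw [MonObj.comp_mul, hp.isoPullback_hom_fst_assoc, hp.isoPullback_hom_snd_assoc, mapElt_mul,
      mapElt_comp, mapElt_comp]

/-- The functor `L*`. -/
def star (Q : OrderedCommMonoid E) : SpanCat S Q ⥤ SpanCat S (L.mapMonoid Q) where
  obj A := ⟨L.mapAlg A.alg⟩
  map {A B} f := Quotient.map
    (fun s => (⟨L.mapSpan s.1, L.isAlgebraic_mapSpan s.2⟩ :
      AlgSpan (L.mapMonoid Q) (L.mapAlg A.alg) (L.mapAlg B.alg)))
    (fun _ _ h => L.mapSpan_congr h) f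
  map_id A := by
    refine SpanCat.ofSpan_eq (A := ⟨L.mapAlg A.alg⟩) (B := ⟨L.mapAlg A.alg⟩)
      (h := L.isAlgebraic_mapSpan (.id _)) (h' := .id _) ?_
    -- The identity span is by definition the graph of the identity.
    have := L.mapSpan_graph (Q := Q) (𝟙 A.alg.carrier)
    rw [CategoryTheory.Functor.map_id] at this
    exact this ▸ .refl _
  map_comp f g := by
    obtain ⟨s, hs, rfl⟩ := SpanCat.ofSpan_surj f
    obtain ⟨t, ht, rfl⟩ := SpanCat.ofSpan_surj g
    exact SpanCat.ofSpan_eq (L.mapSpan_comp s t)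

/-- The homomorphism equation is mapped at the generic tuple and then pulled back along the morphism
classifying x. -/
lemma isHom_map {A B : Algebra S E} {f : A.carrier ⟶ B.carrier} (hf : Algebra.IsHom A B f) :
    Algebra.IsHom (L.mapAlg A) (L.mapAlg B) (L.toFunctor.map f) := by
  intro σ T x
  obtain ⟨w, hw⟩ := L.exists_tuple_map x
  have h := congrArg (fun k => w ≫ L.toFunctor.map k) (hf σ _ (fun i => Pi.π _ i))
  rw [L.toFunctor.map_comp (tuple _ ≫ A.op σ) f, ← tuple_mapOp, ← tuple_mapOp, comp_tuple_assoc,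
    ← Category.assoc, comp_tuple_assoc] at h
  simp only [Functor.map_comp, ← Category.assoc, hw] at h
  exact h

lemma star_map_graph {A B : SpanCat S Q} {f : A.alg.carrier ⟶ B.alg.carrier}
    (hf : Algebra.IsHom A.alg B.alg f) :
    (L.star Q).map (SpanCat.graph f hf) =
      SpanCat.graph (A := (L.star Q).obj A) (B := (L.star Q).obj B) (L.toFunctor.map f)
        (L.isHom_map hf) := by
  refine SpanCat.ofSpan_eq (A := (L.star Q).obj A) (B := (L.star Q).obj B) ?_
  exact L.mapSpan_graph (Q := Q) f ▸ .refl _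

/-- The inverse is the pairing of the images of the two projections, which are homomorphisms; the
inverse of a bijective homomorphism is again one. -/
lemma isHom_prodInv (A B : Algebra S E) :
    Algebra.IsHom ((L.mapAlg A).prod (L.mapAlg B)) (L.mapAlg (A.prod B))
      (L.prodInv A.carrier B.carrier) := by
  have h : Algebra.IsHom (L.mapAlg (A.prod B)) ((L.mapAlg A).prod (L.mapAlg B))
      (Functor.Monoidal.μIso L.toFunctor A.carrier B.carrier).symm.hom := by
    have := (L.isHom_map (Algebra.isHom_fst A B)).lift (L.isHom_map (Algebra.isHom_snd A B))
    have e : (Functor.Monoidal.μIso L.toFunctor A.carrier B.carrier).symm.hom =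
        lift (L.toFunctor.map (fst _ _)) (L.toFunctor.map (snd _ _)) := by
      ext <;> simp
    exact e ▸ this
  exact h.inv

lemma isHom_ε : Algebra.IsHom (Algebra.unit S F) (L.mapAlg (Algebra.unit S E))
    (Functor.LaxMonoidal.ε L.toFunctor) := by
  have h : Algebra.IsHom (L.mapAlg (Algebra.unit S E)) (Algebra.unit S F)
    (Functor.Monoidal.εIso L.toFunctor).symm.hom := fun _ _ _ => toUnit_unique _ _
  exact h.inv

end LogicalFunctor

end

end QSpans

/-! ### The symmetric monoidal structure of L* -/

namespace QSpans

noncomputable section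

variable {E : Type u} [Category.{v} E] [ElementaryTopos E]
variable {F : Type u} [Category.{v} F] [ElementaryTopos F]
variable {S : AlgSignature.{w}} {Q : OrderedCommMonoid E}

lemma SpanCat.graph_congr {A B : SpanCat S Q} {f g : A.alg.carrier ⟶ B.alg.carrier}
    {hf : Algebra.IsHom A.alg B.alg f} {hg : Algebra.IsHom A.alg B.alg g} (h : f = g) :
    graph f hf = graph g hg := by
  subst h; rfl

namespace LogicalFunctor

variable (L : LogicalFunctor E F)

/-- The unit comparison of `L*`: the graph of `1 ≅ L 1`. -/
def starε (Q : OrderedCommMonoid E) : 𝟙_ (SpanCat S (L.mapMonoid Q)) ≅ (L.star Q).obj (𝟙_ _) :=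
  SpanCat.graphIso (A := 𝟙_ (SpanCat S (L.mapMonoid Q))) (B := (L.star Q).obj (𝟙_ _))
    (Functor.Monoidal.εIso L.toFunctor) L.isHom_ε
    (Algebra.IsHom.inv (A := Algebra.unit S F) (B := L.mapAlg (Algebra.unit S E))
      (f := Functor.Monoidal.εIso L.toFunctor) L.isHom_ε)

/-- The tensor comparison of `L*`: the graph of `L A × L B ≅ L (A × B)`. -/
def starμ (A B : SpanCat S Q) : (L.star Q).obj A ⊗ (L.star Q).obj B ≅ (L.star Q).obj (A ⊗ B) :=
  SpanCat.graphIso (A := (L.star Q).obj A ⊗ (L.star Q).obj B) (B := (L.star Q).obj (A ⊗ B))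
    (Functor.Monoidal.μIso L.toFunctor A.alg.carrier B.alg.carrier) (L.isHom_prodInv A.alg B.alg)
    (Algebra.IsHom.inv (A := (L.mapAlg A.alg).prod (L.mapAlg B.alg))
      (B := L.mapAlg (A.alg.prod B.alg))
      (f := Functor.Monoidal.μIso L.toFunctor A.alg.carrier B.alg.carrier)
      (L.isHom_prodInv A.alg B.alg))

lemma starε_hom : (L.starε (S := S) Q).hom =
    SpanCat.graph (A := 𝟙_ (SpanCat S (L.mapMonoid Q))) (B := (L.star Q).obj (𝟙_ _))
      (Functor.LaxMonoidal.ε L.toFunctor) L.isHom_ε := rfl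

lemma starμ_hom (A B : SpanCat S Q) : (L.starμ A B).hom =
    SpanCat.graph (A := (L.star Q).obj A ⊗ (L.star Q).obj B) (B := (L.star Q).obj (A ⊗ B))
      (L.prodInv A.alg.carrier B.alg.carrier) (L.isHom_prodInv A.alg B.alg) := rfl

/-- By `graph_naturality` it suffices to compare apexes, and the comparison isomorphism of the
apexes does this. The legs agree by naturality of μ, the characteristic morphisms because L
preserves multiplication. -/
lemma starμ_natural {A B A' B' : SpanCat S Q} (f : A ⟶ B) (g : A' ⟶ B') :
    ((L.star Q).map f ⊗ₘ (L.star Q).map g) ≫ (L.starμ B B').hom =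
      (L.starμ A A').hom ≫ (L.star Q).map (f ⊗ₘ g) := by
  obtain ⟨s, hs, rfl⟩ := SpanCat.ofSpan_surj f
  obtain ⟨t, ht, rfl⟩ := SpanCat.ofSpan_surj g
  refine SpanCat.ofSpan_eq (A := (L.star Q).obj A ⊗ (L.star Q).obj A')
    (B := (L.star Q).obj (B ⊗ B')) (QSpan.graph_naturality ((L.mapSpan s).tensor (L.mapSpan t))
    (L.mapSpan (s.tensor t)) (Functor.Monoidal.μIso L.toFunctor A.alg.carrier A'.alg.carrier)
    (L.prodInv B.alg.carrier B'.alg.carrier) (Functor.Monoidal.μIso L.toFunctor s.apex t.apex)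
    (Functor.LaxMonoidal.μ_natural _ _ _).symm (Functor.LaxMonoidal.μ_natural _ _ _).symm ?_)
  have k := congrArg L.mapElt (QSpan.tensor_mul (Q := Q) s.char t.char)
  have k' := QSpan.tensor_mul (Q := L.mapMonoid Q) (L.mapElt s.char) (L.mapElt t.char)
  refine (congrArg (L.prodInv _ _ ≫ ·) k).trans (Eq.trans ?_ k'.symm)
  rw [mapElt_mul, MonObj.comp_mul, mapElt_comp, mapElt_comp, Functor.Monoidal.μ_fst_assoc,
    Functor.Monoidal.μ_snd_assoc]

/-- The monoidal structure of `L*`. -/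
def starCore (Q : OrderedCommMonoid E) : (L.star (S := S) Q).CoreMonoidal where
  εIso := L.starε Q
  μIso := L.starμ
  μIso_hom_natural_left f X' := by
    rw [← MonoidalCategory.tensorHom_id, ← MonoidalCategory.tensorHom_id,
      ← CategoryTheory.Functor.map_id]
    exact L.starμ_natural f (𝟙 X')
  μIso_hom_natural_right X' f := by
    rw [← MonoidalCategory.id_tensorHom, ← MonoidalCategory.id_tensorHom,
      ← CategoryTheory.Functor.map_id]
    exact L.starμ_natural (𝟙 X') f
  associativity X Y Z := by
    -- All morphisms involved are graphs, or images of graphs under L*. Both sides collapse to a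
    -- single graph, and the equation becomes the associativity law of L for products; the unit laws
    -- below reduce in the same way.
    simp only [← MonoidalCategory.id_tensorHom, ← MonoidalCategory.tensorHom_id,
      SpanCat.associator_hom_eq, ← SpanCat.graph_id, starμ_hom]
    erw [SpanCat.graph_tensor, SpanCat.graph_tensor, star_map_graph, SpanCat.graph_comp,
      SpanCat.graph_comp, SpanCat.graph_comp, SpanCat.graph_comp]
    apply SpanCat.graph_congr
    have := Functor.LaxMonoidal.associativity L.toFunctor X.alg.carrier Y.alg.carrier Z.alg.carrier
    simp only [← MonoidalCategory.id_tensorHom, ← MonoidalCategory.tensorHom_id] at this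
    exact this
  left_unitality X := by
    simp only [← MonoidalCategory.tensorHom_id, SpanCat.leftUnitor_hom_eq, ← SpanCat.graph_id, starμ_hom, starε_hom]
    erw [SpanCat.graph_tensor, star_map_graph, SpanCat.graph_comp, SpanCat.graph_comp]
    apply SpanCat.graph_congr
    have := Functor.LaxMonoidal.left_unitality L.toFunctor X.alg.carrier
    simp only [← MonoidalCategory.tensorHom_id] at this
    exact this
  right_unitality X := by
    simp only [← MonoidalCategory.id_tensorHom, SpanCat.rightUnitor_hom_eq, ← SpanCat.graph_id, starμ_hom, starε_hom]
    erw [SpanCat.graph_tensor, star_map_graph, SpanCat.graph_comp, SpanCat.graph_comp]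
    apply SpanCat.graph_congr
    have := Functor.LaxMonoidal.right_unitality L.toFunctor X.alg.carrier
    simp only [← MonoidalCategory.id_tensorHom] at this
    exact this

/-- The symmetric monoidal structure of `L*`. -/
instance starBraided (Q : OrderedCommMonoid E) : (L.star (S := S) Q).Braided where
  toMonoidal := (L.starCore Q).toMonoidal
  braided A B := by
    change (L.starμ A B).hom ≫ (L.star Q).map (SpanCat.graph (A := A ⊗ B) (B := B ⊗ A)
        (β_ A.alg.carrier B.alg.carrier).hom (Algebra.isHom_braiding _ _)) =
      SpanCat.graph (A := (L.star Q).obj A ⊗ (L.star Q).obj B)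
        (B := (L.star Q).obj B ⊗ (L.star Q).obj A)
        (β_ (L.toFunctor.obj A.alg.carrier) (L.toFunctor.obj B.alg.carrier)).hom
        (Algebra.isHom_braiding _ _) ≫ (L.starμ B A).hom
    rw [star_map_graph, starμ_hom, starμ_hom]
    erw [SpanCat.graph_comp, SpanCat.graph_comp]
    apply SpanCat.graph_congr
    exact Functor.LaxBraided.braided (F := L.toFunctor) A.alg.carrier B.alg.carrier

/-- `L*` as a symmetric monoidal functor. -/
def starFunctor (S : AlgSignature.{w}) (Q : OrderedCommMonoid E) :
    SymmetricMonoidalFunctor (SpanCat S Q) (SpanCat S (L.mapMonoid Q)) where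
  toFunctor := L.star Q
  braided := L.starBraided Q

lemma isInduced_starFunctor (Q : OrderedCommMonoid E) :
    IsInduced L (L.starFunctor S Q).toFunctor :=
  ⟨fun _ => rfl, fun _ _ _ hs => ⟨L.isAlgebraic_mapSpan hs,
    ((Category.id_comp _).trans (Category.comp_id _)).symm⟩⟩

end LogicalFunctor

end

end QSpans

/-! ### Extensionality of symmetric monoidal functors and transport -/

namespace QSpans

noncomputable section

namespace SymmetricMonoidalFunctor

variable {C D D' : Type*} [Category* C] [Category* D] [Category* D']
  [MonoidalCategory C] [MonoidalCategory D] [MonoidalCategory D'] [SymmetricCategory C]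
  [SymmetricCategory D] [SymmetricCategory D']

/-- The oplax maps η and δ are inverse to ε and μ, hence determined by them. -/
lemma braided_ext {K : C ⥤ D} (b b' : K.Braided) (hε : b.ε = b'.ε)
    (hμ : ∀ X Y, b.μ X Y = b'.μ X Y) : b = b' := by
  have hη : b.η = b'.η := by
    have h1 : b.η ≫ b.ε = 𝟙 _ := b.toMonoidal.η_ε
    have h2 : b'.ε ≫ b'.η = 𝟙 _ := b'.toMonoidal.ε_η
    rw [← Category.comp_id b.η, ← Category.id_comp b'.η, ← h1, Category.assoc, hε, h2]
  have hδ : ∀ X Y, b.δ X Y = b'.δ X Y := by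
    intro X Y
    have h1 : b.δ X Y ≫ b.μ X Y = 𝟙 _ := b.toMonoidal.δ_μ X Y
    have h2 : b'.μ X Y ≫ b'.δ X Y = 𝟙 _ := b'.toMonoidal.μ_δ X Y
    rw [← Category.comp_id (b.δ X Y), ← Category.id_comp (b'.δ X Y), ← h1, Category.assoc, hμ, h2]
  exact Functor.Braided.ext hε (funext₂ hμ) hη (funext₂ hδ)

/-- The data are compared by heterogeneous equality because their types mention the two functors,
which are identified only in the course of the proof. -/
lemma ext_of {K K' : SymmetricMonoidalFunctor C D}
    (hobj : ∀ A, K.toFunctor.obj A = K'.toFunctor.obj A)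
    (hmap : ∀ (A B : C) (f : A ⟶ B), K.toFunctor.map f ≍ K'.toFunctor.map f)
    (hε : Functor.LaxMonoidal.ε K.toFunctor ≍ Functor.LaxMonoidal.ε K'.toFunctor)
    (hμ : ∀ A B, Functor.LaxMonoidal.μ K.toFunctor A B ≍ Functor.LaxMonoidal.μ K'.toFunctor A B) : K = K' := by
  have h : K.toFunctor = K'.toFunctor := Functor.hext hobj hmap
  obtain ⟨k, b⟩ := K
  obtain ⟨k', b'⟩ := K'
  dsimp only at h
  subst h
  congr 1
  exact braided_ext _ _ (eq_of_heq hε) (fun X Y => eq_of_heq (hμ X Y))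

end SymmetricMonoidalFunctor

section Transport

variable {E : Type u} [Category.{v} E] [ElementaryTopos E] {S : AlgSignature.{w}}
  {Q Q' : OrderedCommMonoid E}

namespace SpanCat

lemma transport_obj (h : Q = Q') (A : SpanCat S Q) :
    (transport h).toFunctor.obj A = ⟨A.alg⟩ := by
  subst h; rfl

lemma transport_map (h : Q = Q') {A B : SpanCat S Q} (f : A ⟶ B) :
    (transport h).toFunctor.map f ≍ f := by
  subst h; rfl

/-- The left side is the form of the unit comparison of a functor followed by a transport; this
removes the transport. `μ_transport_comp` plays the same role for the tensor comparison. -/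
lemma ε_transport_comp (h : Q = Q') {A : SpanCat S Q} (f : 𝟙_ (SpanCat S Q) ⟶ A) :
    Functor.LaxMonoidal.ε (transport (S := S) h).toFunctor ≫ (transport h).toFunctor.map f ≍ f := by
  subst h
  exact heq_of_eq (Category.id_comp f)

lemma μ_transport_comp (h : Q = Q') {A B C : SpanCat S Q} (f : A ⊗ B ⟶ C) :
    Functor.LaxMonoidal.μ (transport (S := S) h).toFunctor A B ≫ (transport h).toFunctor.map f ≍ f := by
  subst h
  exact heq_of_eq (Category.id_comp f)

/-- For algebras such as (M ∘ L) A and M (L A), whose equality is not definitional, morphisms lie in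
different types. They can still be compared through representing spans; `graph_heq` does this for
graphs. -/
lemma ofSpan_heq (h : Q = Q') {A B : SpanCat S Q} {A' B' : SpanCat S Q'} (hA : A.alg = A'.alg)
    (hB : B.alg = B'.alg) {s : QSpan Q A.alg.carrier B.alg.carrier}
    {s' : QSpan Q' A'.alg.carrier B'.alg.carrier} (hs : s ≍ s') {a : IsAlgebraic A.alg B.alg s}
    {a' : IsAlgebraic A'.alg B'.alg s'} : ofSpan s a ≍ ofSpan s' a' := by
  subst h
  obtain ⟨A⟩ := A
  obtain ⟨B⟩ := B
  obtain ⟨A'⟩ := A'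
  obtain ⟨B'⟩ := B'
  dsimp only at hA hB
  subst hA
  subst hB
  cases hs
  rfl

lemma graph_heq (h : Q = Q') {A B : SpanCat S Q} {A' B' : SpanCat S Q'} (hA : A.alg = A'.alg)
    (hB : B.alg = B'.alg) {f : A.alg.carrier ⟶ B.alg.carrier}
    {f' : A'.alg.carrier ⟶ B'.alg.carrier} (hf : f ≍ f') {a : Algebra.IsHom A.alg B.alg f}
    {a' : Algebra.IsHom A'.alg B'.alg f'} : graph f a ≍ graph f' a' := by
  subst h
  obtain ⟨A⟩ := A
  obtain ⟨B⟩ := B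
  obtain ⟨A'⟩ := A'
  obtain ⟨B'⟩ := B'
  dsimp only at hA hB
  subst hA
  subst hB
  cases hf
  rfl

end SpanCat

lemma QSpan.mk_heq (h : Q = Q') {A B X : E} (l : X ⟶ A) (r : X ⟶ B) {c : X ⟶ Q.X} {c' : X ⟶ Q'.X}
    (hc : c ≍ c') : (⟨X, l, r, c⟩ : QSpan Q A B) ≍ (⟨X, l, r, c'⟩ : QSpan Q' A B) := by
  subst h; cases hc; rfl

lemma Algebra.ext_of {A : E} {a : ∀ σ : S.Op, pow A (S.arity σ) ⟶ A}
    {b : ∀ σ : S.Op, pow A (S.arity σ) ⟶ A} {ha hb} (h : ∀ σ, a σ = b σ) :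
    (⟨A, a, ha⟩ : Algebra S E) = ⟨A, b, hb⟩ := by
  obtain rfl : a = b := funext h
  rfl

end Transport

/-! ### Functoriality in the logical functor -/

namespace LogicalFunctor

variable {E : Type u} [Category.{v} E] [ElementaryTopos E]
variable {F : Type u} [Category.{v} F] [ElementaryTopos F]
variable {G : Type u} [Category.{v} G] [ElementaryTopos G]
variable {S : AlgSignature.{w}} (L : LogicalFunctor E F) (M : LogicalFunctor F G)

/-- The inverse of (L X)ⁿ ← L(Xⁿ) is determined by its composites with the images of the
projections, so any convenient t with these composites may replace it. -/
lemma mapOp_eq {X : E} {n : ℕ} (f : pow X n ⟶ X)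
    (t : pow (L.toFunctor.obj X) n ⟶ L.toFunctor.obj (pow X n))
    (ht : ∀ i, t ≫ L.toFunctor.map (Pi.π _ i) = Pi.π _ i) :
    L.mapOp f = t ≫ L.toFunctor.map f := by
  rw [mapOp]
  congr 1
  rw [IsIso.inv_eq_of_inv_hom_id]
  apply Pi.hom_ext
  intro i
  rw [Category.assoc, piComparison_comp_π, ht, Category.id_comp]

lemma mapAlg_id (A : Algebra S E) : (id E).mapAlg A = A := by
  refine Algebra.ext_of fun σ => ?_
  exact ((id E).mapOp_eq (A.op σ) (𝟙 _) fun i => Category.id_comp _).trans (Category.id_comp _)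

/-- The carriers agree definitionally; only the power comparisons need an argument. The one for the
composite is that of M followed by M applied to that of L, since this has the correct projections.
-/
lemma mapAlg_comp (A : Algebra S E) : (L.comp M).mapAlg A = M.mapAlg (L.mapAlg A) := by
  refine Algebra.ext_of (A := M.toFunctor.obj (L.toFunctor.obj A.carrier))
    (a := fun σ => (L.comp M).mapOp (A.op σ)) (b := fun σ => M.mapOp (L.mapOp (A.op σ)))
    (ha := ((L.comp M).mapAlg A).sat) (hb := (M.mapAlg (L.mapAlg A)).sat) fun σ => ?_
  obtain ⟨l, hl⟩ := L.exists_tuple_map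
    (fun i => Pi.π (fun _ : Fin (S.arity σ) => L.toFunctor.obj A.carrier) i)
  obtain ⟨m, hm⟩ := M.exists_tuple_map
    (fun i => Pi.π (fun _ : Fin (S.arity σ) => M.toFunctor.obj (L.toFunctor.obj A.carrier)) i)
  have h1 := L.mapOp_eq (A.op σ) l hl
  have h2 := M.mapOp_eq (L.mapOp (A.op σ)) m hm
  refine ((L.comp M).mapOp_eq (A.op σ) (m ≫ M.toFunctor.map l) fun i => ?_).trans
    (Eq.trans ?_ h2.symm)
  · refine Eq.trans ?_ (hm i)
    rw [← hl i, Functor.map_comp, ← Category.assoc]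
    rfl
  · rw [h1, Functor.map_comp, ← Category.assoc]
    rfl

lemma prodInv_id (X Y : E) : (id E).prodInv X Y = 𝟙 (X ⊗ Y) := by
  apply CartesianMonoidalCategory.hom_ext
  · exact (Functor.Monoidal.μ_fst (F := (id E).toFunctor) X Y).trans (Category.id_comp _).symm
  · exact (Functor.Monoidal.μ_snd (F := (id E).toFunctor) X Y).trans (Category.id_comp _).symm

lemma prodInv_comp (X Y : E) : (L.comp M).prodInv X Y =
    M.prodInv (L.toFunctor.obj X) (L.toFunctor.obj Y) ≫ M.toFunctor.map (L.prodInv X Y) :=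
  letI : (L.toFunctor ⋙ M.toFunctor).Monoidal :=
    (inferInstance : (L.comp M).toFunctor.Monoidal)
  Functor.Monoidal.μ_comp L.toFunctor M.toFunctor X Y

lemma ε_comp : Functor.LaxMonoidal.ε (L.comp M).toFunctor =
    Functor.LaxMonoidal.ε M.toFunctor ≫ M.toFunctor.map (Functor.LaxMonoidal.ε L.toFunctor) :=
  (cancel_mono (Functor.Monoidal.εIso (L.comp M).toFunctor).inv).1 (toUnit_unique _ _)

lemma starFunctor_id (Q : OrderedCommMonoid E) :
    ((id E).starFunctor S Q).comp (SpanCat.transport (mapMonoid_id Q)) =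
      SymmetricMonoidalFunctor.id (SpanCat S Q) := by
  apply SymmetricMonoidalFunctor.ext_of
  · intro A
    refine (SpanCat.transport_obj _ _).trans ?_
    exact congrArg SpanCat.mk (mapAlg_id A.alg)
  · intro A B f
    refine (SpanCat.transport_map _ _).trans ?_
    obtain ⟨s, hs, rfl⟩ := SpanCat.ofSpan_surj f
    exact SpanCat.ofSpan_heq (mapMonoid_id Q) (mapAlg_id A.alg) (mapAlg_id B.alg)
      (QSpan.mk_heq (mapMonoid_id Q) _ _ HEq.rfl)
  -- The unit comparison is the graph of a morphism 1 ⟶ 1, which must be the identity.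
  · refine (SpanCat.ε_transport_comp _ _).trans ?_
    exact SpanCat.graph_heq (mapMonoid_id Q) (A := 𝟙_ _) (B := ((id E).star Q).obj (𝟙_ _))
      (A' := 𝟙_ (SpanCat S Q)) (B' := 𝟙_ (SpanCat S Q)) rfl (mapAlg_id _)
      (heq_of_eq (toUnit_unique _ (𝟙 (𝟙_ E))))
      (a := (id E).isHom_ε) (a' := Algebra.isHom_id _)
  · intro A B
    refine (SpanCat.μ_transport_comp _ _).trans ?_
    exact SpanCat.graph_heq (mapMonoid_id Q) (A := ((id E).star Q).obj A ⊗ ((id E).star Q).obj B)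
      (B := ((id E).star Q).obj (A ⊗ B)) (A' := A ⊗ B) (B' := A ⊗ B)
      (congrArg₂ Algebra.prod (mapAlg_id A.alg) (mapAlg_id B.alg)) (mapAlg_id _)
      (heq_of_eq (prodInv_id A.alg.carrier B.alg.carrier))
      (a := (id E).isHom_prodInv A.alg B.alg) (a' := Algebra.isHom_id _)

lemma starFunctor_comp (Q : OrderedCommMonoid E) :
    ((L.comp M).starFunctor S Q).comp (SpanCat.transport (L.mapMonoid_comp M Q)) =
      (L.starFunctor S Q).comp (M.starFunctor S (L.mapMonoid Q)) := by
  apply SymmetricMonoidalFunctor.ext_of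
  · intro A
    refine (SpanCat.transport_obj _ _).trans ?_
    exact congrArg SpanCat.mk (L.mapAlg_comp M A.alg)
  · intro A B f
    refine (SpanCat.transport_map _ _).trans ?_
    obtain ⟨s, hs, rfl⟩ := SpanCat.ofSpan_surj f
    exact SpanCat.ofSpan_heq (L.mapMonoid_comp M Q) (L.mapAlg_comp M A.alg)
      (L.mapAlg_comp M B.alg) (QSpan.mk_heq (L.mapMonoid_comp M Q) _ _ HEq.rfl)
  · refine (SpanCat.ε_transport_comp _ _).trans ?_
    -- The unit comparison of M* ∘ L* is the graph for M followed by the M*-image of the graph for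
    -- L, hence a single graph. Its underlying morphism is the unit comparison of the composite by
    -- `ε_comp`.
    have h := (congrArg (Functor.LaxMonoidal.ε (M.star (S := S) (L.mapMonoid Q)) ≫ ·)
      (M.star_map_graph (A := 𝟙_ (SpanCat S (L.mapMonoid Q))) (B := (L.star Q).obj (𝟙_ _))
        L.isHom_ε)).trans
      (SpanCat.graph_comp (A := 𝟙_ (SpanCat S (M.mapMonoid (L.mapMonoid Q))))
        (B := (M.star (L.mapMonoid Q)).obj (𝟙_ _))
        (C := (M.star (L.mapMonoid Q)).obj ((L.star Q).obj (𝟙_ _)))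
        M.isHom_ε (M.isHom_map L.isHom_ε))
    refine HEq.trans ?_ (heq_of_eq h.symm)
    exact SpanCat.graph_heq (L.mapMonoid_comp M Q) rfl (L.mapAlg_comp M _)
      (heq_of_eq (L.ε_comp M)) (a := (L.comp M).isHom_ε)
  · intro A B
    refine (SpanCat.μ_transport_comp _ _).trans ?_
    -- Likewise the tensor comparison is a single graph, identified by `prodInv_comp`.
    have h := (congrArg (Functor.LaxMonoidal.μ (M.star (L.mapMonoid Q)) ((L.star Q).obj A)
        ((L.star Q).obj B) ≫ ·)
      (M.star_map_graph (A := (L.star Q).obj A ⊗ (L.star Q).obj B) (B := (L.star Q).obj (A ⊗ B))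
        (L.isHom_prodInv A.alg B.alg))).trans
      (SpanCat.graph_comp
        (A := (M.star (L.mapMonoid Q)).obj ((L.star Q).obj A) ⊗
          (M.star (L.mapMonoid Q)).obj ((L.star Q).obj B))
        (B := (M.star (L.mapMonoid Q)).obj ((L.star Q).obj A ⊗ (L.star Q).obj B))
        (C := (M.star (L.mapMonoid Q)).obj ((L.star Q).obj (A ⊗ B)))
        (M.isHom_prodInv (L.mapAlg A.alg) (L.mapAlg B.alg))
        (M.isHom_map (L.isHom_prodInv A.alg B.alg)))
    refine HEq.trans ?_ (heq_of_eq h.symm)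
    exact SpanCat.graph_heq (L.mapMonoid_comp M Q)
      (congrArg₂ Algebra.prod (L.mapAlg_comp M A.alg) (L.mapAlg_comp M B.alg))
      (L.mapAlg_comp M _) (heq_of_eq (L.prodInv_comp M A.alg.carrier B.alg.carrier))
      (a := (L.comp M).isHom_prodInv A.alg B.alg)

end LogicalFunctor

end

end QSpans

theorem mainTheorem10 (S : QSpans.AlgSignature.{w}) :
    ∃ star : ∀ {E F : Type u} [Category.{v} E] [Category.{v} F] [ElementaryTopos E]
        [ElementaryTopos F] (L : QSpans.LogicalFunctor E F) (Q : QSpans.OrderedCommMonoid E),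
        QSpans.SymmetricMonoidalFunctor (QSpans.SpanCat S Q) (QSpans.SpanCat S (L.mapMonoid Q)),
      -- `L*` is given by `A ↦ L A` and `(X, f, g, χ) ↦ (L X, L f, L g, L χ)`
      (∀ {E F : Type u} [Category.{v} E] [Category.{v} F] [ElementaryTopos E] [ElementaryTopos F]
        (L : QSpans.LogicalFunctor E F) (Q : QSpans.OrderedCommMonoid E),
        QSpans.IsInduced L (star L Q).toFunctor) ∧
      -- `(id)* = id`, as symmetric monoidal functors
      (∀ {E : Type u} [Category.{v} E] [ElementaryTopos E] (Q : QSpans.OrderedCommMonoid E),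
        (star (QSpans.LogicalFunctor.id E) Q).comp
            (QSpans.SpanCat.transport (QSpans.LogicalFunctor.mapMonoid_id Q)) =
          QSpans.SymmetricMonoidalFunctor.id (QSpans.SpanCat S Q)) ∧
      -- `(M ∘ L)* = M* ∘ L*`, as symmetric monoidal functors
      (∀ {E F G : Type u} [Category.{v} E] [Category.{v} F] [Category.{v} G] [ElementaryTopos E]
        [ElementaryTopos F] [ElementaryTopos G] (L : QSpans.LogicalFunctor E F)
        (M : QSpans.LogicalFunctor F G) (Q : QSpans.OrderedCommMonoid E),
        (star (L.comp M) Q).comp (QSpans.SpanCat.transport (L.mapMonoid_comp M Q)) =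
          (star L Q).comp (star M (L.mapMonoid Q))) :=
  ⟨fun L Q => L.starFunctor S Q, fun L Q => L.isInduced_starFunctor Q,
    fun Q => QSpans.LogicalFunctor.starFunctor_id Q, fun L M Q => L.starFunctor_comp M Q⟩
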